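/- Work on the Hilbert space $L^2(\mathbb R)$ with $\hbar=1$, position operator $\hat x$ and momentum operator $\hat p=-i\,d/dx$. Let $$D(\alpha,\beta)=\exp(i\sqrt2\,\beta\hat x-i\sqrt2\,\alpha\hat p),\qquad (D(\alpha,\beta)\psi)(x)=e^{-i\alpha\beta+i\sqrt2\beta x}\,\psi(x-\sqrt2\,\alpha),$$ and let $$\Delta(x,y;\theta)=\Big[\frac{1+i\cot\theta}{2\pi}\Big]^{1/2}\exp\Big[-\frac{i(x^2+y^2)\cot\theta}{2}+\frac{ixy}{\sin\theta}\Big]\quad(\sin\theta\ne0),$$ with the principal square root, and $\Delta(x,y;\theta)=\delta(x-y\cos\theta)$ if $\sin\theta=0$ (so $\delta(x-y)$ for $\theta=0$ and $\delta(x+y)$ for $\theta=\pi$). For real $\theta_1,\theta_2$ with $\cos(\theta_1-\theta_2)\neq0$ and real $\alpha,\beta$ let $U(\alpha,\beta;\theta_1,\theta_2)$ be the bounded operator $$U(\alpha,\beta;\theta_1,\theta_2)=|\cos(\theta_1-\theta_2)|^{1/2}\int d\alpha'\,d\beta'\,\Delta(\beta,\alpha';\theta_2)\,\Delta(\alpha,-\beta';\theta_1)\,D(\alpha',\beta'),$$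 the integral being understood weakly, i.e. as an equality of matrix elements between Schwartz functions. For a density operator $\rho$ (positive, of trace one) let $A(\alpha,\beta;\theta_1,\theta_2|\rho)=\mathrm{Tr}[\rho\,U(\alpha,\beta;\theta_1,\theta_2)]$ be its bifractional Wigner function. Let $\langle x|\rho|y\rangle$ and $\langle p|\rho|q\rangle$ be the square-integrable kernels of $\rho$ in the position representation and in the momentum representation, where $\langle p|\psi\rangle=(2\pi)^{-1/2}\int e^{-ipx}\psi(x)\,dx$. A kernel is determined up to a null set, and each of the (a.e. equal) functions that represent it is called a version. Let $\rho$ be a density operator. Then its position and momentum kernels exist, and for all real $\theta_1,\theta_2$ with $\cos(\theta_1-\theta_2)\ne0$ the operators $U(\alpha,\beta;\theta_1,\theta_2)$ exist, the traces $\mathrm{Tr}[\rho\, U(\alpha,\beta;\theta_1,\theta_2)]$ and $\mathrm{Tr}(\rho^2)$ converge in every orthonormal basis, and the following hold. (1) As an identity in $[0,\infty]$, $$\int |A(\alpha,\beta;\theta_1,\theta_2|\rho)|^2\,d\alpha=\sqrt2\,\pi\,|\cos(\theta_1-\theta_2)|\int dx\,\Big|\int d\alpha'\,\Big\langle x-\frac{\alpha'}{\sqrt2}\Big|\rho\Big|x+\frac{\alpha'}{\sqrt2}\Big\rangle\,\Delta(\beta,\alpha';\theta_2)\Big|^2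 .$$ For every version of the position kernel this holds for almost every $\beta$, and for every $\beta$ if $\sin\theta_2\neq0$ (in which case the inner integral converges absolutely for almost every $x$). Moreover there is a version of the position kernel with which it holds for every $\beta$ and all $\theta_1,\theta_2$ with $\cos(\theta_1-\theta_2)\neq 0$. (2) As an identity in $[0,\infty]$, $$\int |A(\alpha,\beta;\theta_1,\theta_2|\rho)|^2\,d\beta=\sqrt2\,\pi\,|\cos(\theta_1-\theta_2)|\int dp\,\Big|\int d\beta'\,\Big\langle p-\frac{\beta'}{\sqrt2}\Big|\rho\Big|p+\frac{\beta'}{\sqrt2}\Big\rangle\,\Delta(\alpha,-\beta';\theta_1)\Big|^2 .$$ For every version of the momentum kernel this holds for almost every $\alpha$, and for every $\alpha$ if $\sin\theta_1\neq0$ (in which case the inner integral converges absolutely for almost every $p$). Moreover there is a version of the momentum kernel with which it holds for every $\alpha$ and all $\theta_1,\theta_2$ with $\cos(\theta_1-\theta_2)\neq 0$. (3) $|A(\cdot,\cdot;\theta_1,\theta_2|\rho)|^2$ is integrable on $\mathbb R^2$ and $$\int |A(\alpha,\beta;\theta_1,\theta_2|\rho)|^2\,d\alpha\,d\beta=\pi\,|\cos(\theta_1-\theta_2)|\,\mathrm{Tr}(\rho^2).$$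 -/

import Mathlib

open MeasureTheory

noncomputable section

namespace Bifractional

/-- The state space `L²(ℝ)` of the harmonic oscillator (with `ħ = 1`). -/
abbrev StateSpace : Type := Lp ℂ 2 (volume : Measure ℝ)

/-! ### Traces and density operators -/

/-- `T` has trace `t`: in every orthonormal basis the diagonal of `T` is (unconditionally)
summable with sum `t`.  This forces `T` to be of trace class. -/
def HasTrace (T : StateSpace →L[ℂ] StateSpace) (t : ℂ) : Prop :=
  ∀ (ι : Type) (b : HilbertBasis ι ℂ StateSpace), HasSum (fun i => inner ℂ (b i) (T (b i))) t

theorem HasTrace.unique {T : StateSpace →L[ℂ] StateSpace} {s t : ℂ}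
    (hs : HasTrace T s) (ht : HasTrace T t) : s = t := by
  obtain ⟨w, b, -⟩ := exists_hilbertBasis ℂ StateSpace
  exact (hs w b).unique (ht w b)

open Classical in
/-- The trace `Tr T` (with value `0` if `T` has no trace). -/
def opTrace (T : StateSpace →L[ℂ] StateSpace) : ℂ :=
  if h : ∃ t, HasTrace T t then h.choose else 0

theorem HasTrace.opTrace_eq {T : StateSpace →L[ℂ] StateSpace} {t : ℂ} (h : HasTrace T t) :
    opTrace T = t := by
  have h' : ∃ t, HasTrace T t := ⟨t, h⟩
  rw [opTrace, dif_pos h']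
  exact h'.choose_spec.unique h

/-- A density operator: positive, of trace one. -/
def IsDensityOperator (ρ : StateSpace →L[ℂ] StateSpace) : Prop :=
  ρ.IsPositive ∧ HasTrace ρ 1

/-! ### Displacement operators -/

/-- The displacement operator `D(α,β) = exp(i√2 β x̂ - i√2 α p̂)`, `p̂ = -i d/dx`, in the position
representation: `(D(α,β)ψ)(x) = exp(-iαβ + i√2 β x) ψ(x - √2 α)`. -/
def displacement (α β : ℝ) (ψ : ℝ → ℂ) (x : ℝ) : ℂ :=
  Complex.exp (Complex.I * ((-(α * β) + √2 * β * x : ℝ) : ℂ)) * ψ (x - √2 * α)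

/-- `t ↦ D(tα,tβ)` is a one-parameter group. -/
theorem displacement_add_smul (α β s t : ℝ) (ψ : ℝ → ℂ) :
    displacement (s * α) (s * β) (displacement (t * α) (t * β) ψ) =
      displacement ((s + t) * α) ((s + t) * β) ψ := by
  funext x
  have h2 : √2 * √2 = 2 := Real.mul_self_sqrt (by norm_num)
  simp only [displacement]
  have e1 : x - √2 * (s * α) - √2 * (t * α) = x - √2 * ((s + t) * α) := by ring
  have e2 : (-(s * α * (s * β)) + √2 * (s * β) * x) +
      (-(t * α * (t * β)) + √2 * (t * β) * (x - √2 * (s * α))) =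
      -((s + t) * α * ((s + t) * β)) + √2 * ((s + t) * β) * x := by
    linear_combination (-(t * β * s * α)) * h2
  rw [← mul_assoc, ← Complex.exp_add, ← mul_add, ← Complex.ofReal_add, e1, e2]

/-- The generator of `t ↦ D(tα,tβ)` is `i√2 β x̂ - i√2 α p̂`. -/
theorem hasDerivAt_displacement (α β x : ℝ) {ψ : ℝ → ℂ} {ψ' : ℂ} (hψ : HasDerivAt ψ ψ' x) :
    HasDerivAt (fun t : ℝ => displacement (t * α) (t * β) ψ x)
      (Complex.I * √2 * β * (x * ψ x) - Complex.I * √2 * α * (-Complex.I * ψ')) 0 := by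
  have h1 : HasDerivAt (fun t : ℝ => -(t * α * (t * β)) + √2 * (t * β) * x) (√2 * β * x) 0 := by
    have ha := ((hasDerivAt_id (0 : ℝ)).mul_const α)
    have hb := ((hasDerivAt_id (0 : ℝ)).mul_const β)
    have := (ha.mul hb).neg.add ((hb.const_mul (√2)).mul_const x)
    refine this.congr_deriv ?_
    simp
  have h2 : HasDerivAt (fun t : ℝ => x - √2 * (t * α)) (-(√2 * α)) 0 := by
    have := (((hasDerivAt_id (0 : ℝ)).mul_const α).const_mul (√2)).const_sub x
    simpa using this
  have h3 : HasDerivAt (fun t : ℝ => ψ (x - √2 * (t * α))) ((-(√2 * α) : ℝ) • ψ') 0 := by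
    have hψ0 : HasDerivAt ψ ψ' (x - √2 * (0 * α)) := by simpa using hψ
    exact hψ0.scomp (0 : ℝ) h2
  have h4 := ((h1.ofReal_comp.const_mul Complex.I).cexp).mul h3
  refine h4.congr_deriv ?_
  simp only [zero_mul, mul_zero, neg_zero, add_zero, sub_zero, Complex.ofReal_zero,
    Complex.exp_zero, Complex.real_smul, Complex.ofReal_neg, Complex.ofReal_mul, one_mul]
  linear_combination (-(√2 : ℂ) * α * ψ') * Complex.I_mul_I

/-- The matrix element `⟨φ|D(α,β)|ψ⟩` between Schwartz functions. -/
def displacementElement (φ ψ : SchwartzMap ℝ ℂ) (α β : ℝ) : ℂ :=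
  ∫ x, (starRingEnd ℂ) (φ x) * displacement α β ψ x

/-! ### The fractional Fourier transform -/

/-- The kernel `Δ(x,y;θ)` for `sin θ ≠ 0`, with the principal square root in the prefactor. -/
def fracKernel (x y θ : ℝ) : ℂ :=
  ((1 + Complex.I * (Real.cot θ : ℂ)) / (2 * (Real.pi : ℂ))) ^ (1 / 2 : ℂ) *
    Complex.exp (-Complex.I * ((x ^ 2 + y ^ 2 : ℝ) : ℂ) * (Real.cot θ : ℂ) / 2 +
      Complex.I * ((x * y : ℝ) : ℂ) / (Real.sin θ : ℂ))

open Classical in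
/-- `∫ dy Δ(x,y;θ) f(y)`.  When `sin θ = 0`, so that `cos θ = ±1`, the kernel is the delta function
`δ(x - y cos θ)`, i.e. `δ(x - y)` for `θ = 0` and `δ(x + y)` for `θ = π`. -/
def fracFourier (θ : ℝ) (f : ℝ → ℂ) (x : ℝ) : ℂ :=
  if Real.sin θ = 0 then f (Real.cos θ * x) else ∫ y, fracKernel x y θ * f y

/-! ### Bifractional displacement operators and Wigner functions -/

/-- `U = |cos(θ₁-θ₂)|^{1/2} ∫∫ dα' dβ' Δ(β,α';θ₂) Δ(α,-β';θ₁) D(α',β')`, as a weak integral: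
the matrix elements of both sides between Schwartz functions agree.
(The inner integral is taken in the variable `b = -β'`.) -/
def IsBifractional (α β θ₁ θ₂ : ℝ) (U : StateSpace →L[ℂ] StateSpace) : Prop :=
  ∀ φ ψ : SchwartzMap ℝ ℂ,
    inner ℂ (φ.toLp 2 volume) (U (ψ.toLp 2 volume)) =
      (√|Real.cos (θ₁ - θ₂)| : ℂ) *
        fracFourier θ₂ (fun a => fracFourier θ₁ (fun b => displacementElement φ ψ a (-b)) α) β

theorem IsBifractional.unique {α β θ₁ θ₂ : ℝ} {U V : StateSpace →L[ℂ] StateSpace}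
    (hU : IsBifractional α β θ₁ θ₂ U) (hV : IsBifractional α β θ₁ θ₂ V) : U = V := by
  have hd : DenseRange (fun ψ : SchwartzMap ℝ ℂ => ψ.toLp 2 volume) :=
    SchwartzMap.denseRange_toLpCLM (F := ℂ) (E := ℝ) (μ := volume) (p := 2) (by simp)
  have key : (U : StateSpace → StateSpace) = V := by
    refine hd.equalizer U.continuous V.continuous ?_
    funext ψ
    exact hd.eq_of_inner_right ℂ fun φ => (hU φ ψ).trans (hV φ ψ).symm
  exact DFunLike.coe_injective key

open Classical in
/-- The bifractional displacement operator `U(α,β;θ₁,θ₂)`: the unique bounded operator given by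
the weak integral in `IsBifractional` (and `0` if there were none). -/
def bifractional (α β θ₁ θ₂ : ℝ) : StateSpace →L[ℂ] StateSpace :=
  if h : ∃ U, IsBifractional α β θ₁ θ₂ U then h.choose else 0

/-- The bifractional Wigner function `A(α,β;θ₁,θ₂|ρ) = Tr(ρ U(α,β;θ₁,θ₂))`. -/
def bifracWigner (α β θ₁ θ₂ : ℝ) (ρ : StateSpace →L[ℂ] StateSpace) : ℂ :=
  opTrace (ρ ∘L bifractional α β θ₁ θ₂)

/-! ### Position and momentum kernels of an operator -/

/-- `k(x,y) = ⟨x|ρ|y⟩`: the square-integrable function with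
`⟨φ|ρ|ψ⟩ = ∫∫ conj(φ(x)) k(x,y) ψ(y) dx dy` (unique up to a null set). -/
def IsPositionKernel (ρ : StateSpace →L[ℂ] StateSpace) (k : ℝ → ℝ → ℂ) : Prop :=
  MemLp (fun z : ℝ × ℝ => k z.1 z.2) 2 volume ∧
    ∀ φ ψ : SchwartzMap ℝ ℂ,
      inner ℂ (φ.toLp 2 volume) (ρ (ψ.toLp 2 volume)) =
        ∫ z : ℝ × ℝ, (starRingEnd ℂ) (φ z.1) * k z.1 z.2 * ψ z.2

/-- The momentum wave function `⟨p|ψ⟩ = (2π)^{-1/2} ∫ e^{-ipx} ψ(x) dx`. -/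
def momentumWave (ψ : ℝ → ℂ) (p : ℝ) : ℂ :=
  ((√(2 * Real.pi))⁻¹ : ℂ) * ∫ x : ℝ, Complex.exp (-Complex.I * ((p * x : ℝ) : ℂ)) * ψ x

/-- `k(p,q) = ⟨p|ρ|q⟩`: the square-integrable function with
`⟨φ|ρ|ψ⟩ = ∫∫ conj(⟨p|φ⟩) k(p,q) ⟨q|ψ⟩ dp dq` (unique up to a null set). -/
def IsMomentumKernel (ρ : StateSpace →L[ℂ] StateSpace) (k : ℝ → ℝ → ℂ) : Prop :=
  MemLp (fun z : ℝ × ℝ => k z.1 z.2) 2 volume ∧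
    ∀ φ ψ : SchwartzMap ℝ ℂ,
      inner ℂ (φ.toLp 2 volume) (ρ (ψ.toLp 2 volume)) =
        ∫ z : ℝ × ℝ, (starRingEnd ℂ) (momentumWave φ z.1) * k z.1 z.2 * momentumWave ψ z.2

/-! ### The marginal identities -/

/-- `∫ |A(α,β)|² dα = √2 π |cos(θ₁-θ₂)| ∫ dx |∫ dα' k(x - α'/√2, x + α'/√2) Δ(β,α';θ₂)|²`,
an identity in `[0,∞]`. -/
def AlphaMarginal (ρ : StateSpace →L[ℂ] StateSpace) (k : ℝ → ℝ → ℂ) (θ₁ θ₂ β : ℝ) : Prop :=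
  ∫⁻ α, ‖bifracWigner α β θ₁ θ₂ ρ‖ₑ ^ 2 =
    ENNReal.ofReal (√2 * Real.pi * |Real.cos (θ₁ - θ₂)|) *
      ∫⁻ x, ‖fracFourier θ₂ (fun a => k (x - a / √2) (x + a / √2)) β‖ₑ ^ 2

/-- `∫ |A(α,β)|² dβ = √2 π |cos(θ₁-θ₂)| ∫ dp |∫ dβ' k(p - β'/√2, p + β'/√2) Δ(α,-β';θ₁)|²`,
an identity in `[0,∞]`.  (The inner integral is taken in the variable `b = -β'`.) -/
def BetaMarginal (ρ : StateSpace →L[ℂ] StateSpace) (k : ℝ → ℝ → ℂ) (θ₁ θ₂ α : ℝ) : Prop :=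
  ∫⁻ β, ‖bifracWigner α β θ₁ θ₂ ρ‖ₑ ^ 2 =
    ENNReal.ofReal (√2 * Real.pi * |Real.cos (θ₁ - θ₂)|) *
      ∫⁻ p, ‖fracFourier θ₁ (fun b => k (p - (-b) / √2) (p + (-b) / √2)) α‖ₑ ^ 2

end Bifractional

end

noncomputable section

namespace Bifractional

open scoped FourierTransform SchwartzMap ENNReal ComplexConjugate ContDiff

/-! ### A weak form of Plancherel's theorem -/

/-! The matrix element of `D(a,-b)` between Schwartz functions φ, ψ is the Fourier transform, u → b
with kernel exp(-i√2bu), of conj φ(u + a/√2) ψ(u - a/√2) (`displacementElement_neg`). Transforming b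
→ α with angle θ₁ and a → β with angle θ₂ gives the matrix elements of U, up to the factor
|cos(θ₁-θ₂)|^{1/2}. A Fresnel integral makes the composite u → b → α explicit: for cos θ₁ ≠ 0 its
kernel is C exp(i(pα² + tan θ₁ u² - (√2/cos θ₁)αu)) with |C|² = 1/|cos θ₁|, and for cos θ₁ = 0 it is
evaluation at a multiple of α. By Fubini, at fixed β the dependence on α is this one transform
applied to `slicedElement`, and in both cases it multiplies the squared L² norm by √2 π.

The condition cos(θ₁-θ₂) ≠ 0 makes the matrix elements bounded in the L² norms
(`exists_norm_bifracElement_le`), which gives the operator U. A density operator is a sum of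
|φ_m⟩⟨ψ_m| with Schwartz functions and ∑ ‖φ_m‖‖ψ_m‖ finite (`exists_hasSchwartzExpansion`), so
Tr(ρU) is a series of matrix elements and ∑ φ_m(x) conj ψ_m(y) is a version of the kernel. Identity
(1) is Plancherel's theorem for the resulting series. Both sides may be infinite, so Plancherel is
needed for a Fourier pair known only by testing against Schwartz functions
(`lintegral_enorm_sq_eq_of_weak_fourier`).

Identity (2) is (1) in the momentum representation: the Fourier transform rotates phase space by a
quarter turn and exchanges the two angles (`bifracElement_momentum`). Identity (3) follows by
integrating (1) over β: Plancherel in a and a linear change of variables leave π|cos(θ₁-θ₂)| times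
the squared L² norm of the kernel, which is Tr(ρ²). Other versions of the kernel differ on a null
set, which is invisible to an integral over almost every slice, but not to a single slice when sin θ
= 0. -/

/-- `f` can be integrated against every Schwartz function. -/
def PairsWithSchwartz (f : ℝ → ℂ) : Prop :=
  ∀ χ : 𝓢(ℝ, ℂ), Integrable (fun x => conj (χ x) * f x)

/-- A bump function equal to 1 on a ball serves as the test function. -/
theorem PairsWithSchwartz.locallyIntegrable {f : ℝ → ℂ} (hf : PairsWithSchwartz f) :
    LocallyIntegrable f := by
  intro x
  let b : ContDiffBump x := ⟨1, 2, by norm_num, by norm_num⟩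
  have hb₁ : HasCompactSupport (Complex.ofRealCLM ∘ b) := b.hasCompactSupport.comp_left rfl
  have hb₂ : ContDiff ℝ ∞ (Complex.ofRealCLM ∘ b) :=
    Complex.ofRealCLM.contDiff.comp b.contDiff
  refine ⟨Metric.closedBall x 1, Metric.closedBall_mem_nhds x one_pos, ?_⟩
  refine ((hf (hb₁.toSchwartzMap hb₂)).integrableOn (s := Metric.closedBall x 1)).congr_fun ?_
    Metric.isClosed_closedBall.measurableSet
  intro y hy
  have : b y = 1 := b.one_of_mem_closedBall hy
  simp [this]

theorem ae_eq_of_integral_schwartz_eq {f g : ℝ → ℂ} (hf : PairsWithSchwartz f)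
    (hg : PairsWithSchwartz g)
    (h : ∀ χ : 𝓢(ℝ, ℂ), ∫ x, conj (χ x) * f x = ∫ x, conj (χ x) * g x) : f =ᵐ[volume] g := by
  refine ae_eq_of_integral_contDiff_smul_eq hf.locallyIntegrable hg.locallyIntegrable ?_
  intro b hb hb'
  have hb₁ : HasCompactSupport (Complex.ofRealCLM ∘ b) := hb'.comp_left rfl
  have hb₂ : ContDiff ℝ ∞ (Complex.ofRealCLM ∘ b) := Complex.ofRealCLM.contDiff.comp hb
  simpa using h (hb₁.toSchwartzMap hb₂)

theorem PairsWithSchwartz.of_memLp {f : ℝ → ℂ} (hf : MemLp f 2) : PairsWithSchwartz f := by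
  intro χ
  have h1 : MemLp (fun x => conj (χ x)) 2 := (χ.memLp 2 volume).star
  exact h1.integrable_mul hf

theorem PairsWithSchwartz.of_integrable {f : ℝ → ℂ} (hf : Integrable f) :
    PairsWithSchwartz f := by
  intro χ
  refine hf.bdd_mul (c := SchwartzMap.seminorm ℝ 0 0 χ) ?_ ?_
  · exact (Complex.continuous_conj.comp χ.continuous).aestronglyMeasurable
  · filter_upwards with x
    simpa using χ.norm_le_seminorm ℝ x

theorem PairsWithSchwartz.of_bounded {f : ℝ → ℂ} (hf : AEStronglyMeasurable f) (C : ℝ)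
    (hC : ∀ x, ‖f x‖ ≤ C) : PairsWithSchwartz f := by
  intro χ
  refine Integrable.mul_bdd (c := C) (g := f) ?_ hf (ae_of_all _ hC)
  exact (Complex.conjCLE : ℂ →L[ℝ] ℂ).integrable_comp χ.integrable

theorem inner_toLp_left (χ : 𝓢(ℝ, ℂ)) (f : StateSpace) :
    inner ℂ (χ.toLp 2 volume) f = ∫ x, conj (χ x) * f x := by
  rw [L2.inner_def]
  refine integral_congr_ae ?_
  filter_upwards [χ.coeFn_toLp 2 volume] with x hx
  rw [hx]; simp [mul_comm]

theorem lintegral_enorm_sq_eq_of_memLp {f g : ℝ → ℂ} (hf : MemLp f 2) (hg : MemLp g 2)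
    (h : ‖hf.toLp f‖ = ‖hg.toLp g‖) : ∫⁻ x, ‖f x‖ₑ ^ 2 = ∫⁻ x, ‖g x‖ₑ ^ 2 := by
  have key : ∀ {f : ℝ → ℂ} (hf : MemLp f 2), ∫⁻ x, ‖f x‖ₑ ^ 2 = ENNReal.ofReal ‖hf.toLp f‖ ^ 2 := by
    intro f hf
    rw [Lp.norm_toLp, ENNReal.ofReal_toReal hf.2.ne,
      eLpNorm_eq_lintegral_rpow_enorm_toReal (by norm_num) (by norm_num), ← ENNReal.rpow_natCast,
      ← ENNReal.rpow_mul]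
    simp
  rw [key hf, key hg, h]

theorem memLp_two_of_lintegral_ne_top {f : ℝ → ℂ} (hf : AEStronglyMeasurable f)
    (h : ∫⁻ x, ‖f x‖ₑ ^ 2 ≠ ⊤) : MemLp f 2 := by
  refine ⟨hf, ?_⟩
  rw [eLpNorm_lt_top_iff_lintegral_rpow_enorm_lt_top (by norm_num) (by norm_num)]
  simpa using h.lt_top

/-- If `B` is the Fourier transform of `G` in the sense of distributions, then `B` and `G` have the
same `L²` norm, finite or not. -/
theorem lintegral_enorm_sq_eq_of_weak_fourier {B G : ℝ → ℂ} (hB : PairsWithSchwartz B)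
    (hG : PairsWithSchwartz G)
    (h : ∀ χ : 𝓢(ℝ, ℂ), ∫ x, conj ((𝓕 χ) x) * B x = ∫ x, conj (χ x) * G x) :
    ∫⁻ x, ‖B x‖ₑ ^ 2 = ∫⁻ x, ‖G x‖ₑ ^ 2 := by
  -- One function in L² suffices: its L² transform (inverse for `B`, direct for `G`) has the same
  -- pairings as the other function, hence agrees with it almost everywhere, and the L² isometry
  -- applies.
  by_cases hG2 : ∫⁻ x, ‖G x‖ₑ ^ 2 = ⊤
  · by_cases hB2 : ∫⁻ x, ‖B x‖ₑ ^ 2 = ⊤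
    · rw [hG2, hB2]
    · have hBm : MemLp B 2 :=
        memLp_two_of_lintegral_ne_top hB.locallyIntegrable.aestronglyMeasurable hB2
      set G' : StateSpace := 𝓕⁻ (hBm.toLp B) with hG'
      have hGG : G =ᵐ[volume] G' := by
        refine ae_eq_of_integral_schwartz_eq hG (.of_memLp (Lp.memLp G')) fun χ => ?_
        rw [← h χ, ← inner_toLp_left, ← Lp.inner_fourier_eq, SchwartzMap.toLp_fourier_eq, hG',
          FourierTransform.fourier_fourierInv_eq, inner_toLp_left]
        refine integral_congr_ae ?_
        filter_upwards [hBm.coeFn_toLp] with x hx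
        rw [hx]
      have hGm : MemLp G 2 := (memLp_congr_ae hGG).2 (Lp.memLp G')
      refine lintegral_enorm_sq_eq_of_memLp hBm hGm ?_
      have : hGm.toLp G = G' := by
        rw [← Lp.toLp_coeFn G' (Lp.memLp G')]
        exact MemLp.toLp_eq_toLp_iff _ _ |>.2 hGG
      rw [this, ← Lp.norm_fourier_eq G', hG', FourierTransform.fourier_fourierInv_eq]
  · have hGm : MemLp G 2 :=
      memLp_two_of_lintegral_ne_top hG.locallyIntegrable.aestronglyMeasurable hG2
    set B' : StateSpace := 𝓕 (hGm.toLp G) with hB'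
    have hBB : B =ᵐ[volume] B' := by
      refine ae_eq_of_integral_schwartz_eq hB (.of_memLp (Lp.memLp B')) fun χ => ?_
      -- The hypothesis tests `B` only against Fourier transforms, but every Schwartz function is
      -- one.
      have e := h (𝓕⁻ χ)
      rw [FourierTransform.fourier_fourierInv_eq] at e
      rw [e, ← inner_toLp_left, hB']
      have e2 : χ.toLp 2 volume = (𝓕 (𝓕⁻ χ)).toLp 2 volume := by
        rw [FourierTransform.fourier_fourierInv_eq]
      rw [e2, ← SchwartzMap.toLp_fourier_eq, Lp.inner_fourier_eq, inner_toLp_left]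
      refine integral_congr_ae ?_
      filter_upwards [hGm.coeFn_toLp] with x hx
      rw [hx]
    have hBm : MemLp B 2 := (memLp_congr_ae hBB).2 (Lp.memLp B')
    refine lintegral_enorm_sq_eq_of_memLp hBm hGm ?_
    have : hBm.toLp B = B' := by
      rw [← Lp.toLp_coeFn B' (Lp.memLp B')]
      exact MemLp.toLp_eq_toLp_iff _ _ |>.2 hBB
    rw [this, hB', Lp.norm_fourier_eq]

/-- Moving the transform across the pairing by Fubini turns it into the inverse transform, which
recovers `χ` from `𝓕 χ`. -/
theorem integral_conj_fourier_mul_fourier {G : ℝ → ℂ} (hG : Integrable G) (χ : 𝓢(ℝ, ℂ)) :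
    ∫ x, conj ((𝓕 χ) x) * (𝓕 G) x = ∫ x, conj (χ x) * G x := by
  let χ₁ : 𝓢(ℝ, ℂ) := 𝓕 χ
  let χ' : ℝ → ℂ := ⇑χ₁
  have hχ' : Integrable χ' := χ₁.integrable
  have h := VectorFourier.integral_sesq_fourierIntegral_eq_neg_flip (innerSL ℂ (E := ℂ))
    (V := ℝ) (W := ℝ) (μ := volume) (ν := volume) (e := Real.fourierChar)
    (L := innerₗ ℝ) (f := G) (g := χ') Real.continuous_fourierChar (by fun_prop) hG hχ'
  have h2 : ∀ x, VectorFourier.fourierIntegral Real.fourierChar volume (-(innerₗ ℝ).flip)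
      χ' x = χ x := by
    intro x
    have h5 : (𝓕⁻ (𝓕 χ)) x = χ x := by rw [FourierTransform.fourierInv_fourier_eq]
    rw [← h5, SchwartzMap.fourierInv_coe]
    simp only [FourierTransformInv.fourierInv]
    congr 2
    ext; simp
  simp only [h2] at h
  have h3 := congrArg conj h
  rw [← integral_conj, ← integral_conj] at h3
  simp only [innerSL_apply_apply, RCLike.inner_apply, map_mul, Complex.conj_conj] at h3
  exact h3

/-! ### Series of integrable functions -/

theorem ae_summable_norm_of_summable_integral_norm {α : Type*} [MeasurableSpace α] {μ : Measure α}
    {F : ℕ → α → ℂ} (hF : ∀ m, Integrable (F m) μ) (hs : Summable fun m => ∫ x, ‖F m x‖ ∂μ) :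
    ∀ᵐ x ∂μ, Summable fun m => ‖F m x‖ := by
  have h : ∫⁻ x, ∑' m, ‖F m x‖ₑ ∂μ ≠ ⊤ := by
    rw [lintegral_tsum fun m => (hF m).aestronglyMeasurable.enorm]
    have e : ∀ m, ∫⁻ x, ‖F m x‖ₑ ∂μ = ENNReal.ofReal (∫ x, ‖F m x‖ ∂μ) := fun m => by
      rw [ofReal_integral_norm_eq_lintegral_enorm (hF m)]
    simp only [e]
    rw [← ENNReal.ofReal_tsum_of_nonneg (fun m => integral_nonneg fun x => norm_nonneg _) hs]
    exact ENNReal.ofReal_ne_top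
  have h2 := ae_lt_top' (AEMeasurable.tsum fun m => (hF m).aestronglyMeasurable.enorm) h
  filter_upwards [h2] with x hx
  have := ENNReal.summable_toReal hx.ne
  simpa using this

/-- The pointwise sum takes its default value only where the series is not summable, which is a null
set. -/
theorem integrable_tsum_of_summable_integral_norm {α : Type*} [MeasurableSpace α] {μ : Measure α}
    {F : ℕ → α → ℂ} (hF : ∀ m, Integrable (F m) μ) (hs : Summable fun m => ∫ x, ‖F m x‖ ∂μ) :
    Integrable (fun x => ∑' m, F m x) μ := by
  have h := ae_summable_norm_of_summable_integral_norm hF hs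
  refine ⟨?_, ?_⟩
  · refine aestronglyMeasurable_of_tendsto_ae Filter.atTop
      (f := fun (n : ℕ) x => ∑ m ∈ Finset.range n, F m x) (fun n => ?_) ?_
    · exact (integrable_finsetSum _ fun m _ => hF m).aestronglyMeasurable
    · filter_upwards [h] with x hx
      exact hx.of_norm.hasSum.tendsto_sum_nat
  · have h3 : ∫⁻ x, ∑' m, ‖F m x‖ₑ ∂μ < ⊤ := by
      rw [lintegral_tsum fun m => (hF m).aestronglyMeasurable.enorm]
      have e : ∀ m, ∫⁻ x, ‖F m x‖ₑ ∂μ = ENNReal.ofReal (∫ x, ‖F m x‖ ∂μ) := fun m => by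
        rw [ofReal_integral_norm_eq_lintegral_enorm (hF m)]
      simp only [e]
      rw [← ENNReal.ofReal_tsum_of_nonneg (fun m => integral_nonneg fun x => norm_nonneg _) hs]
      exact ENNReal.ofReal_lt_top
    exact (lintegral_mono fun x => enorm_tsum_le_tsum_enorm).trans_lt h3

/-! ### Quadratic-phase transforms -/

/-- Scaling is a measurable equivalence, so no measurability of `f` is required. -/
theorem lintegral_comp_mul_left (f : ℝ → ℝ≥0∞) {r : ℝ} (hr : r ≠ 0) :
    ∫⁻ x, f (r * x) = ENNReal.ofReal |r⁻¹| * ∫⁻ x, f x := by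
  have h := lintegral_map_equiv (μ := (volume : Measure ℝ)) f
    (Homeomorph.mulLeft₀ r hr).toMeasurableEquiv
  have h2 : Measure.map (Homeomorph.mulLeft₀ r hr).toMeasurableEquiv (volume : Measure ℝ) =
      ENNReal.ofReal |r⁻¹| • volume := Real.map_volume_mul_left hr
  rw [h2, lintegral_smul_measure] at h
  exact h.symm

/-- The phase `exp(i t)`. -/
def phase (t : ℝ) : ℂ := Complex.exp (Complex.I * t)

@[simp] theorem norm_phase (t : ℝ) : ‖phase t‖ = 1 := by
  rw [phase, mul_comm]; exact Complex.norm_exp_ofReal_mul_I t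

@[simp] theorem enorm_phase (t : ℝ) : ‖phase t‖ₑ = 1 := by
  rw [← ofReal_norm, norm_phase, ENNReal.ofReal_one]

theorem phase_add (s t : ℝ) : phase (s + t) = phase s * phase t := by
  simp [phase, mul_add, Complex.exp_add]

@[simp] theorem phase_zero : phase 0 = 1 := by simp [phase]

@[fun_prop]
theorem continuous_phase : Continuous phase := by unfold phase; fun_prop

@[fun_prop]
theorem measurable_phase : Measurable phase := continuous_phase.measurable

theorem integrable_phase_mul {α : Type*} [MeasurableSpace α] {μ : Measure α} {f : α → ℂ}
    (hf : Integrable f μ) {g : α → ℝ} (hg : Measurable g) :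
    Integrable (fun x => phase (g x) * f x) μ := by
  refine hf.bdd_mul (c := 1) (measurable_phase.comp hg).aestronglyMeasurable ?_
  filter_upwards with x
  simp

/-- The transform with kernel `C exp(i(p x² + q y² + r x y))`. -/
def quadTransform (C : ℂ) (p q r : ℝ) (f : ℝ → ℂ) (x : ℝ) : ℂ :=
  C * phase (p * x ^ 2) * ∫ y, phase (q * y ^ 2 + r * x * y) * f y

theorem fourier_eq_integral_phase (f : ℝ → ℂ) (ξ : ℝ) :
    (𝓕 f) ξ = ∫ y, phase (-(2 * Real.pi * ξ) * y) * f y := by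
  rw [Real.fourier_real_eq_integral_exp_smul]
  refine integral_congr_ae (ae_of_all _ fun y => ?_)
  simp only [phase, smul_eq_mul]
  congr 2
  push_cast; ring

theorem quadTransform_eq_fourier (C : ℂ) (p q r : ℝ) (f : ℝ → ℂ) (x : ℝ) :
    quadTransform C p q r f x =
      C * phase (p * x ^ 2) * (𝓕 fun y => phase (q * y ^ 2) * f y) (-(r / (2 * Real.pi)) * x) := by
  rw [fourier_eq_integral_phase, quadTransform]
  congr 2
  ext y
  rw [← mul_assoc, ← phase_add]
  congr 2
  field_simp
  ring

theorem norm_quadTransform_le (C : ℂ) (p q r : ℝ) (f : ℝ → ℂ) (x : ℝ) :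
    ‖quadTransform C p q r f x‖ ≤ ‖C‖ * ∫ y, ‖f y‖ := by
  rw [quadTransform, norm_mul, norm_mul, norm_phase, mul_one]
  gcongr
  refine (norm_integral_le_integral_norm _).trans_eq ?_
  simp

theorem measurable_quadTransform (C : ℂ) (p q r : ℝ) {f : ℝ → ℂ} (hf : Measurable f) :
    Measurable (quadTransform C p q r f) := by
  unfold quadTransform
  refine (by fun_prop : Measurable fun x : ℝ => C * phase (p * x ^ 2)).mul ?_
  refine StronglyMeasurable.measurable ?_
  refine StronglyMeasurable.integral_prod_right (f := fun x y : ℝ =>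
    phase (q * y ^ 2 + r * x * y) * f y) (Measurable.stronglyMeasurable ?_)
  unfold Function.uncurry
  fun_prop

/-- Plancherel for the chirped function enters as the hypothesis `h`, so that the same computation
of constants serves a single function and a series. The outer chirp has modulus one, and rescaling
the argument produces 2π/|r|. -/
theorem lintegral_quadTransform_eq {C : ℂ} (p q : ℝ) {r : ℝ} (hr : r ≠ 0)
    (f B : ℝ → ℂ) (h : ∫⁻ x, ‖B x‖ₑ ^ 2 = ∫⁻ x, ‖phase (q * x ^ 2) * f x‖ₑ ^ 2) :
    ∫⁻ x, ‖C * phase (p * x ^ 2) * B (-(r / (2 * Real.pi)) * x)‖ₑ ^ 2 =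
      ENNReal.ofReal (‖C‖ ^ 2 * (2 * Real.pi / |r|)) * ∫⁻ x, ‖f x‖ₑ ^ 2 := by
  have hr' : -(r / (2 * Real.pi)) ≠ 0 := by
    have := Real.pi_ne_zero
    simp [hr]
  simp only [enorm_mul, enorm_phase, mul_one, one_mul, mul_pow] at h ⊢
  rw [lintegral_const_mul' _ _ (by simp), lintegral_comp_mul_left (fun x => ‖B x‖ₑ ^ 2) hr', h,
    ← mul_assoc]
  congr 1
  rw [← ofReal_norm, ← ENNReal.ofReal_pow (norm_nonneg _), ← ENNReal.ofReal_mul (by positivity)]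
  congr 2
  rw [abs_inv, abs_neg, abs_div, abs_of_pos (by positivity : 0 < 2 * Real.pi), inv_div]

/-- Since `f` is only integrable, both sides may be infinite; hence the weak form of Plancherel. -/
theorem lintegral_quadTransform (C : ℂ) (p q : ℝ) {r : ℝ} (hr : r ≠ 0) {f : ℝ → ℂ}
    (hf : Integrable f) :
    ∫⁻ x, ‖quadTransform C p q r f x‖ₑ ^ 2 =
      ENNReal.ofReal (‖C‖ ^ 2 * (2 * Real.pi / |r|)) * ∫⁻ x, ‖f x‖ₑ ^ 2 := by
  simp only [quadTransform_eq_fourier]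
  refine lintegral_quadTransform_eq p q hr f _ ?_
  have hG : Integrable fun y => phase (q * y ^ 2) * f y := integrable_phase_mul hf (by fun_prop)
  refine lintegral_enorm_sq_eq_of_weak_fourier ?_ (.of_integrable hG)
    (integral_conj_fourier_mul_fourier hG)
  refine .of_bounded ?_ (∫ y, ‖phase (q * y ^ 2) * f y‖) fun ξ => ?_
  · exact (VectorFourier.fourierIntegral_continuous Real.continuous_fourierChar
      (by fun_prop) hG).aestronglyMeasurable
  · exact VectorFourier.norm_fourierIntegral_le_integral_norm _ _ _ _ _

theorem continuous_fourier_of_integrable {G : ℝ → ℂ} (hG : Integrable G) :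
    Continuous (𝓕 G : ℝ → ℂ) :=
  VectorFourier.fourierIntegral_continuous Real.continuous_fourierChar (by fun_prop) hG

/-- Plancherel's identity for a series of integrable functions. -/
theorem lintegral_tsum_fourier {G : ℕ → ℝ → ℂ} (hG : ∀ m, Integrable (G m))
    (hGs : ∀ χ : 𝓢(ℝ, ℂ), Summable fun m => ∫ x, ‖χ x‖ * ‖G m x‖)
    {B : ℕ → ℝ → ℂ} (hBG : ∀ m, B m = 𝓕 (G m))
    {b : ℕ → ℝ} (hb : Summable b) (hB : ∀ m ξ, ‖B m ξ‖ ≤ b m) :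
    ∫⁻ x, ‖∑' m, B m x‖ₑ ^ 2 = ∫⁻ x, ‖∑' m, G m x‖ₑ ^ 2 := by
  have hBm : ∀ m, Continuous (B m) := fun m => by
    rw [hBG m]; exact continuous_fourier_of_integrable (hG m)
  have hGs' : ∀ χ : 𝓢(ℝ, ℂ), Summable fun m => ∫ x, ‖conj (χ x) * G m x‖ := by
    intro χ
    simpa only [norm_mul, RCLike.norm_conj] using hGs χ
  have hGi : ∀ (χ : 𝓢(ℝ, ℂ)) m, Integrable fun x => conj (χ x) * G m x := fun χ m =>
    PairsWithSchwartz.of_integrable (hG m) χ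
  have hBi : ∀ (χ : 𝓢(ℝ, ℂ)) m, Integrable fun x => conj (χ x) * B m x := fun χ m =>
    PairsWithSchwartz.of_bounded (hBm m).aestronglyMeasurable _ (hB m) χ
  have hBs : ∀ χ : 𝓢(ℝ, ℂ), Summable fun m => ∫ x, ‖conj (χ x) * B m x‖ := by
    intro χ
    refine Summable.of_nonneg_of_le (fun m => integral_nonneg fun x => norm_nonneg _)
      (fun m => ?_) (hb.mul_left (∫ x, ‖χ x‖))
    rw [← integral_mul_const]
    refine integral_mono (hBi χ m).norm (χ.integrable.norm.mul_const _) fun x => ?_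
    simp only [norm_mul, RCLike.norm_conj]
    gcongr
    exact hB m x
  -- The sum of the `G m` need not be integrable, so its transform is identified by testing: against
  -- a Schwartz function both series may be integrated term by term.
  refine lintegral_enorm_sq_eq_of_weak_fourier ?_ ?_ ?_
  · intro χ
    have := integrable_tsum_of_summable_integral_norm (hBi χ) (hBs χ)
    simpa only [tsum_mul_left] using this
  · intro χ
    have := integrable_tsum_of_summable_integral_norm (hGi χ) (hGs' χ)
    simpa only [tsum_mul_left] using this
  · intro χ
    simp only [← tsum_mul_left]
    rw [← integral_tsum_of_summable_integral_norm (hBi _) (hBs _),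
      ← integral_tsum_of_summable_integral_norm (hGi χ) (hGs' χ)]
    refine tsum_congr fun m => ?_
    rw [hBG m]
    exact integral_conj_fourier_mul_fourier (hG m) χ

/-- Plancherel's identity for a series of quadratic-phase transforms. -/
theorem lintegral_tsum_quadTransform {C : ℂ} (hC : C ≠ 0) (p q : ℝ) {r : ℝ} (hr : r ≠ 0)
    {f : ℕ → ℝ → ℂ} (hf : ∀ m, Integrable (f m))
    (hfs : ∀ χ : 𝓢(ℝ, ℂ), Summable fun m => ∫ x, ‖χ x‖ * ‖f m x‖)
    {b : ℕ → ℝ} (hb : Summable b) (hF : ∀ m x, ‖quadTransform C p q r (f m) x‖ ≤ b m) :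
    ∫⁻ x, ‖∑' m, quadTransform C p q r (f m) x‖ₑ ^ 2 =
      ENNReal.ofReal (‖C‖ ^ 2 * (2 * Real.pi / |r|)) * ∫⁻ x, ‖∑' m, f m x‖ₑ ^ 2 := by
  have hr' : -(r / (2 * Real.pi)) ≠ 0 := by
    have := Real.pi_ne_zero
    simp [hr]
  obtain ⟨B, hBG⟩ : ∃ B : ℕ → ℝ → ℂ, ∀ m, B m = 𝓕 fun y => phase (q * y ^ 2) * f m y :=
    ⟨_, fun m => rfl⟩
  have hQ : ∀ m x, quadTransform C p q r (f m) x =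
      C * phase (p * x ^ 2) * B m (-(r / (2 * Real.pi)) * x) := by
    intro m x
    rw [hBG, quadTransform_eq_fourier]
  -- Chirps have modulus one and the rescaled argument runs over all of ℝ, so a uniform bound on the
  -- quadratic-phase transforms is one on the Fourier transforms.
  have hB : ∀ m ξ, ‖B m ξ‖ ≤ ‖C‖⁻¹ * b m := by
    intro m ξ
    have := hF m ((-(r / (2 * Real.pi)))⁻¹ * ξ)
    rw [hQ, mul_inv_cancel_left₀ hr', norm_mul, norm_mul, norm_phase, mul_one] at this
    rw [le_inv_mul_iff₀ (norm_pos_iff.2 hC)]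
    exact this
  simp only [hQ, tsum_mul_left]
  refine lintegral_quadTransform_eq p q hr (fun x => ∑' m, f m x) (fun ξ => ∑' m, B m ξ) ?_
  simp only [← tsum_mul_left]
  refine lintegral_tsum_fourier (fun m => integrable_phase_mul (hf m) (by fun_prop)) ?_ hBG
    (hb.mul_left _) hB
  intro χ
  simpa only [norm_mul, norm_phase, one_mul] using hfs χ

/-! ### The kernel of the fractional Fourier transform -/

/-- The prefactor of `fracKernel`. -/
def fracConst (θ : ℝ) : ℂ :=
  ((1 + Complex.I * (Real.cot θ : ℂ)) / (2 * (Real.pi : ℂ))) ^ (1 / 2 : ℂ)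

theorem fracKernel_eq (x y θ : ℝ) : fracKernel x y θ = fracConst θ *
    phase (-(Real.cot θ / 2) * x ^ 2) *
      phase (-(Real.cot θ / 2) * y ^ 2 + (Real.sin θ)⁻¹ * x * y) := by
  rw [mul_assoc, ← phase_add, fracKernel, fracConst, phase]
  congr 2
  push_cast
  ring

theorem norm_cpow_half_sq {z : ℂ} : ‖z ^ (1 / 2 : ℂ)‖ ^ 2 = ‖z‖ := by
  rw [← norm_pow, ← Complex.cpow_nat_mul]
  simp

theorem norm_one_add_I_mul_cot {θ : ℝ} (h : Real.sin θ ≠ 0) :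
    ‖1 + Complex.I * (Real.cot θ : ℂ)‖ = |Real.sin θ|⁻¹ := by
  have e : 1 + Complex.I * (Real.cot θ : ℂ) =
      ((Real.sin θ : ℝ) : ℂ)⁻¹ * (Real.sin θ + Complex.I * Real.cos θ) := by
    rw [Real.cot_eq_cos_div_sin]
    have : ((Real.sin θ : ℝ) : ℂ) ≠ 0 := by exact_mod_cast h
    push_cast at this ⊢
    field_simp
  rw [e, norm_mul, norm_inv, Complex.norm_real, Real.norm_eq_abs]
  have : ‖(Real.sin θ + Complex.I * Real.cos θ : ℂ)‖ = 1 := by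
    rw [mul_comm, Complex.norm_add_mul_I, Real.sin_sq_add_cos_sq, Real.sqrt_one]
  rw [this, mul_one]

theorem norm_fracConst_sq {θ : ℝ} (h : Real.sin θ ≠ 0) :
    ‖fracConst θ‖ ^ 2 = (2 * Real.pi * |Real.sin θ|)⁻¹ := by
  rw [fracConst, norm_cpow_half_sq, norm_div, norm_one_add_I_mul_cot h, norm_mul,
    Complex.norm_real, Real.norm_eq_abs, abs_of_pos Real.pi_pos, mul_inv, div_eq_mul_inv]
  simp [mul_comm]

theorem fracFourier_of_sin_eq_zero {θ : ℝ} (h : Real.sin θ = 0) (f : ℝ → ℂ) (x : ℝ) :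
    fracFourier θ f x = f (Real.cos θ * x) := if_pos h

theorem fracFourier_of_sin_ne_zero {θ : ℝ} (h : Real.sin θ ≠ 0) (f : ℝ → ℂ) (x : ℝ) :
    fracFourier θ f x = quadTransform (fracConst θ) (-(Real.cot θ / 2)) (-(Real.cot θ / 2))
      (Real.sin θ)⁻¹ f x := by
  rw [fracFourier, if_neg h, quadTransform, ← integral_const_mul]
  refine integral_congr_ae (ae_of_all _ fun y => ?_)
  simp only [fracKernel_eq]
  ring

/-- Δ(x,-y;θ) = Δ(-x,y;θ). This moves the sign in Δ(α,-β';θ₁) onto α. -/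
theorem fracFourier_neg (θ : ℝ) (f : ℝ → ℂ) (x : ℝ) :
    fracFourier θ (fun y => f (-y)) x = fracFourier θ f (-x) := by
  by_cases h : Real.sin θ = 0
  · simp [fracFourier_of_sin_eq_zero h]
  · rw [fracFourier, fracFourier, if_neg h, if_neg h, ← integral_neg_eq_self]
    refine integral_congr_ae (ae_of_all _ fun y => ?_)
    simp only [neg_neg, fracKernel]
    congr 3
    push_cast
    ring

/-- Plancherel's identity for the fractional Fourier transform. -/
theorem lintegral_fracFourier (θ : ℝ) {f : ℝ → ℂ} (hf : Integrable f) :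
    ∫⁻ x, ‖fracFourier θ f x‖ₑ ^ 2 = ∫⁻ x, ‖f x‖ₑ ^ 2 := by
  by_cases h : Real.sin θ = 0
  · have hc : |Real.cos θ| = 1 := by
      have := Real.sin_sq_add_cos_sq θ
      rw [h] at this
      rw [← sq_eq_sq₀ (abs_nonneg _) zero_le_one, sq_abs]
      linarith
    have hc0 : Real.cos θ ≠ 0 := fun h0 => by simp [h0] at hc
    simp only [fracFourier_of_sin_eq_zero h]
    rw [lintegral_comp_mul_left (fun x => ‖f x‖ₑ ^ 2) hc0, abs_inv, hc]
    simp
  · simp only [fracFourier_of_sin_ne_zero h]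
    rw [lintegral_quadTransform _ _ _ (inv_ne_zero h) hf, norm_fracConst_sq h]
    have : (2 * Real.pi * |Real.sin θ|)⁻¹ * (2 * Real.pi / |(Real.sin θ)⁻¹|) = 1 := by
      have h1 : |Real.sin θ| ≠ 0 := by simpa using h
      have := Real.pi_ne_zero
      rw [abs_inv]
      field_simp
    rw [this, ENNReal.ofReal_one, one_mul]

/-! ### The Fresnel integral -/

/-- The Fourier transform with kernel `exp(-i√2 b u)`. -/
def sqrtTwoFourier (h : ℝ → ℂ) (b : ℝ) : ℂ := ∫ u, phase (-(√2 * b) * u) * h u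

theorem sqrtTwoFourier_eq_fourier (h : ℝ → ℂ) (b : ℝ) :
    sqrtTwoFourier h b = (𝓕 h) (√2 / (2 * Real.pi) * b) := by
  rw [fourier_eq_integral_phase, sqrtTwoFourier]
  congr 1
  ext u
  have := Real.pi_ne_zero
  congr 2
  field_simp

/-- The Gaussian damping makes the double integral absolutely convergent, so Fubini and the Gaussian
Fourier integral apply. The damping is removed in `fresnel`. -/
theorem regularized_fresnel {h : ℝ → ℂ} (hh : Integrable h) (ξ : ℝ) {z : ℂ} (hz : 0 < z.re) :
    ∫ b : ℝ, Complex.exp (-z * b ^ 2) * (phase (ξ * b) * sqrtTwoFourier h b) =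
      (Real.pi / z) ^ (1 / 2 : ℂ) *
        ∫ u : ℝ, Complex.exp (-((ξ - √2 * u : ℝ) : ℂ) ^ 2 / (4 * z)) * h u := by
  have hg : Integrable fun b : ℝ => Complex.exp (-z * b ^ 2) := integrable_cexp_neg_mul_sq hz
  have hprod : Integrable (Function.uncurry fun b u : ℝ =>
      phase (ξ * b - √2 * b * u) * (Complex.exp (-z * b ^ 2) * h u)) (volume.prod volume) := by
    exact integrable_phase_mul (hg.mul_prod hh) (g := fun p : ℝ × ℝ => ξ * p.1 - √2 * p.1 * p.2)
      (by fun_prop)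
  calc _ = ∫ b : ℝ, ∫ u : ℝ, phase (ξ * b - √2 * b * u) * (Complex.exp (-z * b ^ 2) * h u) := by
        refine integral_congr_ae (ae_of_all _ fun b => ?_)
        simp only [sqrtTwoFourier]
        rw [← mul_assoc, ← integral_const_mul]
        refine integral_congr_ae (ae_of_all _ fun u => ?_)
        simp only []
        rw [show ξ * b - √2 * b * u = ξ * b + (-(√2 * b) * u) by ring, phase_add]
        ring
    _ = ∫ u : ℝ, ∫ b : ℝ, phase (ξ * b - √2 * b * u) * (Complex.exp (-z * b ^ 2) * h u) :=
        integral_integral_swap hprod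
    _ = _ := by
        rw [← integral_const_mul]
        refine integral_congr_ae (ae_of_all _ fun u => ?_)
        simp only []
        rw [← mul_assoc, ← fourierIntegral_gaussian hz, ← integral_mul_const]
        refine integral_congr_ae (ae_of_all _ fun b => ?_)
        simp only [phase]
        rw [← mul_assoc]
        congr 3
        push_cast; ring

/-- 1/z stays in the closed right half-plane; this dominates the limit in `fresnel`. -/
theorem norm_exp_neg_sq_div_le {z : ℂ} (hz : 0 ≤ z.re) (t : ℝ) :
    ‖Complex.exp (-((t : ℝ) : ℂ) ^ 2 / (4 * z))‖ ≤ 1 := by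
  rw [Complex.norm_exp, Real.exp_le_one_iff]
  have e : -((t : ℝ) : ℂ) ^ 2 / (4 * z) = ((-(t ^ 2) / 4 : ℝ) : ℂ) * z⁻¹ := by
    push_cast; field_simp
  rw [e, Complex.re_ofReal_mul, Complex.inv_re]
  have : 0 ≤ z.re / Complex.normSq z := div_nonneg hz (Complex.normSq_nonneg z)
  nlinarith [sq_nonneg t, mul_nonneg (sq_nonneg t) this]

/-- The Fresnel integral, tested against a function with integrable Fourier transform. -/
theorem fresnel {h : ℝ → ℂ} (hh : Integrable h) (hh' : Integrable (sqrtTwoFourier h)) (ξ : ℝ)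
    {τ : ℝ} (hτ : τ ≠ 0) :
    ∫ b : ℝ, phase (-(τ / 2) * b ^ 2 + ξ * b) * sqrtTwoFourier h b =
      (Real.pi / (Complex.I * (τ / 2 : ℝ))) ^ (1 / 2 : ℂ) *
        ∫ u : ℝ, phase ((ξ - √2 * u) ^ 2 / (2 * τ)) * h u := by
  -- The purely imaginary parameter iτ/2 is approached from the right half-plane.
  let z : ℕ → ℂ := fun n => ((1 / ((n : ℝ) + 1) : ℝ) : ℂ) + Complex.I * (τ / 2 : ℝ)
  have hzre : ∀ n, (z n).re = 1 / ((n : ℝ) + 1) := fun n => by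
    simp [z, -Complex.ofReal_div, -Complex.ofReal_add, -Complex.ofReal_one, -Complex.ofReal_natCast]
  have hzpos : ∀ n, 0 < (z n).re := fun n => by rw [hzre]; positivity
  have hz : Filter.Tendsto z Filter.atTop (nhds (Complex.I * (τ / 2 : ℝ))) := by
    have := ((Complex.continuous_ofReal.tendsto 0).comp
      (tendsto_one_div_add_atTop_nhds_zero_nat (𝕜 := ℝ))).add_const (Complex.I * (τ / 2 : ℝ))
    simpa [z] using this
  have hτ2 : ((τ / 2 : ℝ) : ℂ) ≠ 0 := by
    exact_mod_cast div_ne_zero hτ two_ne_zero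
  have hw0 : Complex.I * ((τ / 2 : ℝ) : ℂ) ≠ 0 := mul_ne_zero Complex.I_ne_zero hτ2
  have hL : Filter.Tendsto
      (fun n => ∫ b : ℝ, Complex.exp (-z n * b ^ 2) * (phase (ξ * b) * sqrtTwoFourier h b))
      Filter.atTop (nhds (∫ b : ℝ, phase (-(τ / 2) * b ^ 2 + ξ * b) * sqrtTwoFourier h b)) := by
    refine tendsto_integral_of_dominated_convergence (fun b => ‖sqrtTwoFourier h b‖) (fun n => ?_)
      hh'.norm (fun n => ae_of_all _ fun b => ?_) (ae_of_all _ fun b => ?_)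
    · exact (by fun_prop : Continuous fun b : ℝ =>
        Complex.exp (-z n * b ^ 2)).aestronglyMeasurable.mul
        (integrable_phase_mul hh' (by fun_prop)).aestronglyMeasurable
    · rw [norm_mul, norm_mul, norm_phase, one_mul]
      refine mul_le_of_le_one_left (norm_nonneg _) ?_
      rw [Complex.norm_exp, Real.exp_le_one_iff]
      have : (-z n * (b : ℂ) ^ 2).re = -((z n).re * b ^ 2) := by
        rw [← Complex.ofReal_pow, Complex.re_mul_ofReal]; simp
      rw [this]
      have := mul_nonneg (hzpos n).le (sq_nonneg b)
      linarith
    · have e : phase (-(τ / 2) * b ^ 2 + ξ * b) * sqrtTwoFourier h b =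
          Complex.exp (-(Complex.I * (τ / 2 : ℝ)) * b ^ 2) *
            (phase (ξ * b) * sqrtTwoFourier h b) := by
        rw [phase_add, mul_assoc]
        congr 1
        rw [phase]
        congr 1
        push_cast; ring
      rw [e]
      exact (((hz.neg.mul_const _).cexp)).mul_const _
  have hR : Filter.Tendsto (fun n => (Real.pi / z n) ^ (1 / 2 : ℂ) *
        ∫ u : ℝ, Complex.exp (-((ξ - √2 * u : ℝ) : ℂ) ^ 2 / (4 * z n)) * h u) Filter.atTop
      (nhds ((Real.pi / (Complex.I * (τ / 2 : ℝ))) ^ (1 / 2 : ℂ) *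
        ∫ u : ℝ, phase ((ξ - √2 * u) ^ 2 / (2 * τ)) * h u)) := by
    refine Filter.Tendsto.mul ?_ ?_
    -- The limit is a nonzero imaginary number, off the branch cut, so the principal root is
    -- continuous there.
    · have hs : Real.pi / (Complex.I * (τ / 2 : ℝ)) ∈ Complex.slitPlane := by
        right
        have e : Real.pi / (Complex.I * ((τ / 2 : ℝ) : ℂ)) =
            ((-(Real.pi / (τ / 2)) : ℝ) : ℂ) * Complex.I := by
          push_cast at hτ2 ⊢
          field_simp
          rw [Complex.I_sq]
          ring
        rw [e, Complex.im_ofReal_mul, Complex.I_im, mul_one]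
        exact neg_ne_zero.2 (div_ne_zero Real.pi_ne_zero (div_ne_zero hτ two_ne_zero))
      exact (continuousAt_cpow_const hs).tendsto.comp
        (tendsto_const_nhds.div hz hw0)
    · refine tendsto_integral_of_dominated_convergence (fun u => ‖h u‖) (fun n => ?_)
        hh.norm (fun n => ae_of_all _ fun u => ?_) (ae_of_all _ fun u => ?_)
      · exact (by fun_prop : Measurable fun u : ℝ => Complex.exp
          (-((ξ - √2 * u : ℝ) : ℂ) ^ 2 / (4 * z n))).aestronglyMeasurable.mul
          hh.aestronglyMeasurable
      · rw [norm_mul]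
        exact mul_le_of_le_one_left (norm_nonneg _) (norm_exp_neg_sq_div_le (hzpos n).le _)
      · have e : phase ((ξ - √2 * u) ^ 2 / (2 * τ)) =
            Complex.exp (-((ξ - √2 * u : ℝ) : ℂ) ^ 2 / (4 * (Complex.I * (τ / 2 : ℝ)))) := by
          rw [phase]
          congr 1
          have : (τ : ℂ) ≠ 0 := by exact_mod_cast hτ
          push_cast
          field_simp
          rw [Complex.I_sq]
          ring
        rw [e]
        exact (((tendsto_const_nhds.div (hz.const_mul 4)
          (mul_ne_zero (by norm_num) hw0)).cexp)).mul_const _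
  refine tendsto_nhds_unique hL (hR.congr fun n => ?_)
  exact (regularized_fresnel hh ξ (hzpos n)).symm

/-- For sin θ ≠ 0 the kernel in b is a chirp, and `fresnel` integrates it out. Only the modulus of C
matters later: |C|² = (2π|sin θ|)⁻¹ · 2π|tan θ|. For sin θ = 0 there is no chirp and cos θ = 1/cos
θ. -/
theorem exists_fracFourier_sqrtTwoFourier_eq_quadTransform {θ : ℝ} (hc : Real.cos θ ≠ 0) :
    ∃ (C : ℂ) (p : ℝ), ‖C‖ ^ 2 = |Real.cos θ|⁻¹ ∧ ∀ h : ℝ → ℂ, Integrable h →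
      Integrable (sqrtTwoFourier h) → ∀ x, fracFourier θ (sqrtTwoFourier h) x =
        quadTransform C p (Real.tan θ) (-(√2 / Real.cos θ)) h x := by
  by_cases hs : Real.sin θ = 0
  · have hc2 : Real.cos θ ^ 2 = 1 := by
      have := Real.sin_sq_add_cos_sq θ
      rw [hs] at this
      linarith
    have hc1 : |Real.cos θ| = 1 := by
      rw [← sq_eq_sq₀ (abs_nonneg _) zero_le_one, sq_abs, hc2, one_pow]
    refine ⟨1, 0, by simp [hc1], fun h _ _ x => ?_⟩
    rw [fracFourier_of_sin_eq_zero hs, sqrtTwoFourier, quadTransform]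
    simp only [zero_mul, phase_zero, mul_one, one_mul]
    congr 1
    ext u
    congr 2
    rw [Real.tan_eq_sin_div_cos, hs]
    field_simp
    rw [hc2]
    ring
  · have hcot : Real.cot θ ≠ 0 := by
      rw [Real.cot_eq_cos_div_sin]; exact div_ne_zero hc hs
    refine ⟨fracConst θ * (Real.pi / (Complex.I * (Real.cot θ / 2 : ℝ))) ^ (1 / 2 : ℂ),
      -(Real.cot θ / 2) + ((Real.sin θ)⁻¹ ^ 2 / (2 * Real.cot θ)), ?_, fun h hh hh' x => ?_⟩
    · rw [norm_mul, mul_pow, norm_cpow_half_sq, norm_fracConst_sq hs, norm_div, norm_mul,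
        Complex.norm_I, Complex.norm_real, Complex.norm_real, Real.norm_eq_abs, Real.norm_eq_abs,
        abs_of_pos Real.pi_pos, Real.cot_eq_cos_div_sin, abs_div, abs_div, abs_two]
      have h1 : |Real.sin θ| ≠ 0 := by simpa using hs
      have h2 : |Real.cos θ| ≠ 0 := by simpa using hc
      have := Real.pi_ne_zero
      field_simp
    · rw [fracFourier_of_sin_ne_zero hs, quadTransform]
      have e : ∀ b : ℝ, phase (-(Real.cot θ / 2) * b ^ 2 + (Real.sin θ)⁻¹ * x * b) *
          sqrtTwoFourier h b = phase (-(Real.cot θ / 2) * b ^ 2 + ((Real.sin θ)⁻¹ * x) * b) *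
          sqrtTwoFourier h b := fun b => rfl
      rw [fresnel hh hh' ((Real.sin θ)⁻¹ * x) hcot, quadTransform, ← integral_const_mul,
        ← integral_const_mul, ← integral_const_mul]
      refine integral_congr_ae (ae_of_all _ fun u => ?_)
      -- Expanding the square yields the coefficients tan θ of u² and -√2/cos θ of xu.
      have e1 : phase (-(Real.cot θ / 2) * x ^ 2) *
          phase (((Real.sin θ)⁻¹ * x - √2 * u) ^ 2 / (2 * Real.cot θ)) =
          phase ((-(Real.cot θ / 2) + ((Real.sin θ)⁻¹ ^ 2 / (2 * Real.cot θ))) * x ^ 2) *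
          phase (Real.tan θ * u ^ 2 + -(√2 / Real.cos θ) * x * u) := by
        rw [← phase_add, ← phase_add]
        congr 1
        have h2 : √2 ^ 2 = 2 := Real.sq_sqrt (by norm_num)
        rw [Real.tan_eq_sin_div_cos, Real.cot_eq_cos_div_sin]
        field_simp
        ring_nf
        rw [h2]
        ring
      simp only []
      linear_combination (fracConst θ *
        (Real.pi / (Complex.I * (Real.cot θ / 2 : ℝ))) ^ (1 / 2 : ℂ) * h u) * e1

/-- Here cot θ = 0, so the fractional kernel is a plane wave and undoes the first transform.
Continuity of `h` makes the Fourier inversion valid at every point. The constant is |C|² = (2π)⁻¹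
(√2 π)² = π. -/
theorem exists_fracFourier_sqrtTwoFourier_eq_eval {θ : ℝ} (hc : Real.cos θ = 0) :
    ∃ C : ℂ, ‖C‖ ^ 2 = Real.pi ∧ ∀ h : ℝ → ℂ, Continuous h → Integrable h →
      Integrable (sqrtTwoFourier h) → ∀ x, fracFourier θ (sqrtTwoFourier h) x =
        C * h (Real.sin θ / √2 * x) := by
  have hs2 : Real.sin θ ^ 2 = 1 := by
    have := Real.sin_sq_add_cos_sq θ
    rw [hc] at this
    linarith
  have hs : Real.sin θ ≠ 0 := fun h0 => by simp [h0] at hs2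
  have hs1 : |Real.sin θ| = 1 := by
    rw [← sq_eq_sq₀ (abs_nonneg _) zero_le_one, sq_abs, hs2, one_pow]
  have hcot : Real.cot θ = 0 := by rw [Real.cot_eq_cos_div_sin, hc, zero_div]
  have h2 : √2 * √2 = 2 := Real.mul_self_sqrt (by norm_num)
  have h20 : √2 ≠ 0 := by positivity
  have hpi := Real.pi_ne_zero
  refine ⟨fracConst θ * (√2 * Real.pi : ℝ), ?_, fun h hcont hh hh' x => ?_⟩
  · rw [norm_mul, mul_pow, norm_fracConst_sq hs, hs1, Complex.norm_real, Real.norm_eq_abs, sq_abs]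
    field_simp
    linarith
  · have hr : √2 / (2 * Real.pi) ≠ 0 := by positivity
    have hF : Integrable (𝓕 h) := by
      have := hh'.comp_mul_left' (inv_ne_zero hr)
      refine this.congr (ae_of_all _ fun ξ => ?_)
      simp only [sqrtTwoFourier_eq_fourier, mul_inv_cancel_left₀ hr]
    rw [fracFourier_of_sin_ne_zero hs, quadTransform, hcot,
      ← congrFun (hcont.fourierInv_fourier_eq hh hF) (Real.sin θ / √2 * x), Real.fourierInv_eq']
    simp only [zero_div, neg_zero, zero_mul, zero_add, phase_zero, mul_one]
    have hcv := Measure.integral_comp_mul_left (fun ξ : ℝ =>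
      phase ((Real.sin θ)⁻¹ * x * ((2 * Real.pi / √2) * ξ)) * (𝓕 h) ξ) (√2 / (2 * Real.pi))
    have e : ∀ b : ℝ, phase ((Real.sin θ)⁻¹ * x * b) * sqrtTwoFourier h b =
        phase ((Real.sin θ)⁻¹ * x * ((2 * Real.pi / √2) * (√2 / (2 * Real.pi) * b))) *
          (𝓕 h) (√2 / (2 * Real.pi) * b) := by
      intro b
      rw [sqrtTwoFourier_eq_fourier]
      congr 3
      field_simp
    simp only [e]
    rw [hcv, mul_assoc]
    congr 1
    rw [abs_of_pos (by positivity), Complex.real_smul, inv_div]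
    congr 1
    · congr 1
      field_simp
      linarith
    · refine integral_congr_ae (ae_of_all _ fun ξ => ?_)
      simp only [smul_eq_mul, phase]
      congr 2
      rw [mul_comm Complex.I]
      congr 2
      have hinv : (Real.sin θ)⁻¹ = Real.sin θ := by
        field_simp; exact hs2.symm
      rw [hinv]
      simp
      ring

/-! ### The coordinates `(x + a/√2, x - a/√2)` -/

/-- The linear change of variables `(u, a) ↦ (u + a/√2, u - a/√2)`. -/
def diagonalEquiv : ℝ × ℝ ≃ᵐ ℝ × ℝ where
  toFun z := (z.1 + z.2 / √2, z.1 - z.2 / √2)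
  invFun z := ((z.1 + z.2) / 2, (z.1 - z.2) / √2)
  left_inv z := by
    have h2 : √2 * √2 = 2 := Real.mul_self_sqrt (by norm_num)
    have h20 : √2 ≠ 0 := by positivity
    ext
    · simp
    · simp only [add_sub_sub_cancel]
      field_simp
      linear_combination (-z.2) * h2
  right_inv z := by
    have h2 : √2 * √2 = 2 := Real.mul_self_sqrt (by norm_num)
    have h20 : √2 ≠ 0 := by positivity
    ext
    · simp only []
      rw [div_div, h2]; ring
    · simp only []
      rw [div_div, h2]; ring
  measurable_toFun := by
    change Measurable fun z : ℝ × ℝ => (z.1 + z.2 / √2, z.1 - z.2 / √2)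
    fun_prop
  measurable_invFun := by
    change Measurable fun z : ℝ × ℝ => ((z.1 + z.2) / 2, (z.1 - z.2) / √2)
    fun_prop

@[simp] theorem diagonalEquiv_apply (z : ℝ × ℝ) :
    diagonalEquiv z = (z.1 + z.2 / √2, z.1 - z.2 / √2) := rfl

/-- The determinant has modulus √2. A translation in u and a scaling of a by √2 reduce this to one
dimension. -/
theorem lintegral_diagonalEquiv {F : ℝ × ℝ → ℝ≥0∞} (hF : Measurable F) :
    ∫⁻ z, F (diagonalEquiv z) = ENNReal.ofReal (√2)⁻¹ * ∫⁻ z, F z := by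
  have h2 : √2 * √2 = 2 := Real.mul_self_sqrt (by norm_num)
  have h20 : √2 ≠ 0 := by positivity
  have e : ∀ t a : ℝ, t + a / √2 + a / √2 = t + √2 * a := fun t a => by
    field_simp
    linear_combination (-a) * h2
  rw [Measure.volume_eq_prod, lintegral_prod_symm _ (by fun_prop), lintegral_prod_symm _ hF.aemeasurable]
  calc ∫⁻ a, ∫⁻ u, F (diagonalEquiv (u, a))
      = ∫⁻ a : ℝ, ∫⁻ t : ℝ, F (t + √2 * a, t) := by
        refine lintegral_congr fun a => ?_
        rw [← lintegral_add_right_eq_self _ (a / √2)]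
        refine lintegral_congr fun t => ?_
        simp [e]
    _ = ∫⁻ t : ℝ, ∫⁻ a : ℝ, F (t + √2 * a, t) := lintegral_lintegral_swap (by fun_prop)
    _ = ∫⁻ t : ℝ, ENNReal.ofReal (√2)⁻¹ * ∫⁻ s : ℝ, F (s, t) := by
        refine lintegral_congr fun t => ?_
        rw [lintegral_comp_mul_left (fun s => F (t + s, t)) h20, abs_of_pos (by positivity),
          lintegral_add_left_eq_self (fun s => F (s, t)) t]
    _ = _ := lintegral_const_mul _ (by fun_prop)

theorem map_diagonalEquiv :
    (volume : Measure (ℝ × ℝ)).map diagonalEquiv = ENNReal.ofReal (√2)⁻¹ • volume := by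
  ext s hs
  rw [← lintegral_indicator_one hs, lintegral_map_equiv,
    lintegral_diagonalEquiv (measurable_one.indicator hs), lintegral_indicator_one hs,
    Measure.smul_apply, smul_eq_mul]

theorem integrable_comp_diagonalEquiv {F : ℝ × ℝ → ℂ} (hF : Integrable F) :
    Integrable fun z => F (diagonalEquiv z) := by
  refine (integrable_map_equiv diagonalEquiv F).1 ?_
  rw [map_diagonalEquiv]
  exact hF.smul_measure ENNReal.ofReal_ne_top

theorem integral_comp_diagonalEquiv (F : ℝ × ℝ → ℂ) :
    ∫ z, F (diagonalEquiv z) = (√2)⁻¹ * ∫ z, F z := by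
  rw [← integral_map_equiv diagonalEquiv F, map_diagonalEquiv, integral_smul_measure,
    ENNReal.toReal_ofReal (by positivity)]
  simp

theorem ae_comp_diagonalEquiv {P : ℝ × ℝ → Prop} (hP : ∀ᵐ z, P z) :
    ∀ᵐ z, P (diagonalEquiv z) := by
  have h : ∀ᵐ z ∂((volume : Measure (ℝ × ℝ)).map diagonalEquiv), P z := by
    rw [map_diagonalEquiv]
    exact Measure.ae_smul_measure hP _
  exact ae_of_ae_map diagonalEquiv.measurable.aemeasurable h

/-! ### Shifted products of Schwartz functions -/

/-- `conj φ(u + a/√2) ψ(u - a/√2)`. -/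
def shiftProduct (φ ψ : ℝ → ℂ) (u a : ℝ) : ℂ := conj (φ (u + a / √2)) * ψ (u - a / √2)

theorem measurable_shiftProduct (φ ψ : 𝓢(ℝ, ℂ)) :
    Measurable fun z : ℝ × ℝ => shiftProduct φ ψ z.1 z.2 := by
  have h1 := φ.continuous
  have h2 := ψ.continuous
  have : Continuous fun z : ℝ × ℝ => shiftProduct φ ψ z.1 z.2 := by
    unfold shiftProduct
    fun_prop
  exact this.measurable

theorem integrable_shiftProduct (φ ψ : 𝓢(ℝ, ℂ)) :
    Integrable (fun z : ℝ × ℝ => shiftProduct φ ψ z.1 z.2) := by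
  have h : Integrable (fun z : ℝ × ℝ => conj (φ z.1) * ψ z.2) (volume.prod volume) :=
    ((Complex.conjCLE : ℂ →L[ℝ] ℂ).integrable_comp φ.integrable).mul_prod ψ.integrable
  exact integrable_comp_diagonalEquiv h

/-- The `L²` norm of a Schwartz function. -/
abbrev normL2 (φ : 𝓢(ℝ, ℂ)) : ℝ := ‖φ.toLp 2 volume‖

theorem lintegral_enorm_sq_schwartz (φ : 𝓢(ℝ, ℂ)) :
    ∫⁻ x, ‖φ x‖ₑ ^ 2 = ENNReal.ofReal (normL2 φ) ^ 2 := by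
  rw [normL2, SchwartzMap.norm_toLp, ENNReal.ofReal_toReal (φ.memLp 2 volume).2.ne,
    eLpNorm_eq_lintegral_rpow_enorm_toReal (by norm_num) (by norm_num), ← ENNReal.rpow_natCast,
    ← ENNReal.rpow_mul]
  simp

theorem lintegral_enorm_mul_le_of_sq {f g : ℝ → ℂ} (hf : Measurable f) (hg : Measurable g)
    {A B : ℝ} (hA : 0 ≤ A) (hfA : ∫⁻ x, ‖f x‖ₑ ^ 2 ≤ ENNReal.ofReal A ^ 2)
    (hgB : ∫⁻ x, ‖g x‖ₑ ^ 2 ≤ ENNReal.ofReal B ^ 2) :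
    ∫⁻ x, ‖f x‖ₑ * ‖g x‖ₑ ≤ ENNReal.ofReal (A * B) := by
  have h := ENNReal.lintegral_mul_le_Lp_mul_Lq (volume : Measure ℝ) Real.HolderConjugate.two_two
    hf.enorm.aemeasurable hg.enorm.aemeasurable
  simp only [ENNReal.rpow_two, Pi.mul_apply] at h
  refine h.trans ?_
  rw [ENNReal.ofReal_mul hA]
  have key : ∀ {x y : ℝ≥0∞}, x ≤ y ^ 2 → x ^ (1 / 2 : ℝ) ≤ y := by
    intro x y hxy
    refine (ENNReal.rpow_le_rpow hxy (by norm_num)).trans_eq ?_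
    rw [← ENNReal.rpow_two, ← ENNReal.rpow_mul]
    simp
  exact mul_le_mul' (key hfA) (key hgB)

/-- Cauchy–Schwarz and translation invariance. This bound and the next involve only L² norms and are
uniform in the other variable, so they can be summed over an expansion of ρ. -/
theorem lintegral_shiftProduct_left (φ ψ : 𝓢(ℝ, ℂ)) (a : ℝ) :
    ∫⁻ u, ‖shiftProduct φ ψ u a‖ₑ ≤ ENNReal.ofReal (normL2 φ * normL2 ψ) := by
  have h1 := φ.continuous
  have h2 := ψ.continuous
  simp only [shiftProduct, enorm_mul]
  have e : ∀ z : ℂ, ‖conj z‖ₑ = ‖z‖ₑ := fun z => by simp [← ofReal_norm]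
  simp only [e]
  refine lintegral_enorm_mul_le_of_sq (f := fun u => φ (u + a / √2)) (g := fun u => ψ (u - a / √2))
    (by fun_prop) (by fun_prop) (norm_nonneg _) ?_ ?_
  · rw [lintegral_add_right_eq_self (fun u => ‖φ u‖ₑ ^ 2), lintegral_enorm_sq_schwartz]
  · rw [lintegral_sub_right_eq_self (fun u => ‖ψ u‖ₑ ^ 2), lintegral_enorm_sq_schwartz]

theorem lintegral_shiftProduct_right (φ ψ : 𝓢(ℝ, ℂ)) (u : ℝ) :
    ∫⁻ a, ‖shiftProduct φ ψ u a‖ₑ ≤ ENNReal.ofReal (√2 * (normL2 φ * normL2 ψ)) := by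
  have h1 := φ.continuous
  have h2 := ψ.continuous
  have h20 : (√2)⁻¹ ≠ 0 := by positivity
  simp only [shiftProduct, enorm_mul, div_eq_inv_mul]
  rw [lintegral_comp_mul_left (fun s => ‖conj (φ (u + s))‖ₑ * ‖ψ (u - s)‖ₑ) h20, inv_inv,
    abs_of_pos (by positivity), ENNReal.ofReal_mul (by positivity)]
  gcongr
  have e : ∀ z : ℂ, ‖conj z‖ₑ = ‖z‖ₑ := fun z => by simp [← ofReal_norm]
  simp only [e]
  refine lintegral_enorm_mul_le_of_sq (f := fun s => φ (u + s)) (g := fun s => ψ (u - s))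
    (by fun_prop) (by fun_prop) (norm_nonneg _) ?_ ?_
  · rw [lintegral_add_left_eq_self (fun u => ‖φ u‖ₑ ^ 2), lintegral_enorm_sq_schwartz]
  · rw [lintegral_sub_left_eq_self (fun u => ‖ψ u‖ₑ ^ 2), lintegral_enorm_sq_schwartz]

theorem continuous_shiftProduct_left (φ ψ : 𝓢(ℝ, ℂ)) (a : ℝ) :
    Continuous fun u => shiftProduct φ ψ u a := by
  have h1 := φ.continuous
  have h2 := ψ.continuous
  unfold shiftProduct
  fun_prop

theorem continuous_shiftProduct_right (φ ψ : 𝓢(ℝ, ℂ)) (u : ℝ) :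
    Continuous fun a => shiftProduct φ ψ u a := by
  have h1 := φ.continuous
  have h2 := ψ.continuous
  unfold shiftProduct
  fun_prop

theorem integrable_shiftProduct_left (φ ψ : 𝓢(ℝ, ℂ)) (a : ℝ) :
    Integrable fun u => shiftProduct φ ψ u a :=
  ⟨(continuous_shiftProduct_left φ ψ a).aestronglyMeasurable,
    (lintegral_shiftProduct_left φ ψ a).trans_lt ENNReal.ofReal_lt_top⟩

theorem integrable_shiftProduct_right (φ ψ : 𝓢(ℝ, ℂ)) (u : ℝ) :
    Integrable fun a => shiftProduct φ ψ u a :=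
  ⟨(continuous_shiftProduct_right φ ψ u).aestronglyMeasurable,
    (lintegral_shiftProduct_right φ ψ u).trans_lt ENNReal.ofReal_lt_top⟩

theorem integral_norm_shiftProduct_left_le (φ ψ : 𝓢(ℝ, ℂ)) (a : ℝ) :
    ∫ u, ‖shiftProduct φ ψ u a‖ ≤ normL2 φ * normL2 ψ := by
  rw [integral_norm_eq_lintegral_enorm (integrable_shiftProduct_left φ ψ a).aestronglyMeasurable]
  exact ENNReal.toReal_le_of_le_ofReal (by positivity) (lintegral_shiftProduct_left φ ψ a)

theorem integral_norm_shiftProduct_right_le (φ ψ : 𝓢(ℝ, ℂ)) (u : ℝ) :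
    ∫ a, ‖shiftProduct φ ψ u a‖ ≤ √2 * (normL2 φ * normL2 ψ) := by
  rw [integral_norm_eq_lintegral_enorm (integrable_shiftProduct_right φ ψ u).aestronglyMeasurable]
  exact ENNReal.toReal_le_of_le_ofReal (by positivity) (lintegral_shiftProduct_right φ ψ u)

/-! ### The matrix elements of the displacement operators -/

/-- Substituting x = u + a/√2 makes the two shifts symmetric and cancels the constant phase of the
displacement operator. -/
theorem displacementElement_neg (φ ψ : 𝓢(ℝ, ℂ)) (a b : ℝ) :
    displacementElement φ ψ a (-b) = sqrtTwoFourier (fun u => shiftProduct φ ψ u a) b := by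
  have h2 : √2 * √2 = 2 := Real.mul_self_sqrt (by norm_num)
  have h20 : √2 ≠ 0 := by positivity
  rw [displacementElement, sqrtTwoFourier,
    ← integral_add_right_eq_self _ (a / √2)]
  refine integral_congr_ae (ae_of_all _ fun u => ?_)
  have e1 : u + a / √2 - √2 * a = u - a / √2 := by
    field_simp; linear_combination (-a) * h2
  have e2 : -(a * -b) + √2 * -b * (u + a / √2) = -(√2 * b) * u := by
    field_simp; ring
  simp only [displacement, shiftProduct, e1, e2, phase]
  ring

theorem hasDerivAt_shiftProduct (φ ψ : 𝓢(ℝ, ℂ)) (u a : ℝ) :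
    HasDerivAt (fun u => shiftProduct φ ψ u a)
      (shiftProduct (SchwartzMap.derivCLM ℂ ℂ φ) ψ u a +
        shiftProduct φ (SchwartzMap.derivCLM ℂ ℂ ψ) u a) u := by
  have h1 : HasDerivAt (fun u => φ (u + a / √2)) (deriv φ (u + a / √2)) u :=
    (φ.hasDerivAt (u + a / √2)).comp_add_const u (a / √2)
  have h2 : HasDerivAt (fun u => ψ (u - a / √2)) (deriv ψ (u - a / √2)) u :=
    (ψ.hasDerivAt (u - a / √2)).comp_sub_const u (a / √2)
  exact (h1.star).mul h2

theorem norm_fourier_shiftProduct_deriv (φ ψ : 𝓢(ℝ, ℂ)) (a ξ : ℝ) :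
    (𝓕 fun u => (shiftProduct (SchwartzMap.derivCLM ℂ ℂ φ) ψ u a +
        shiftProduct φ (SchwartzMap.derivCLM ℂ ℂ ψ) u a)) ξ =
      (2 * Real.pi * Complex.I * ξ) * (𝓕 fun u => shiftProduct φ ψ u a) ξ := by
  have hd : deriv (fun u => shiftProduct φ ψ u a) = fun u =>
      (shiftProduct (SchwartzMap.derivCLM ℂ ℂ φ) ψ u a +
        shiftProduct φ (SchwartzMap.derivCLM ℂ ℂ ψ) u a) :=
    funext fun u => (hasDerivAt_shiftProduct φ ψ u a).deriv
  have h := Real.fourier_deriv (integrable_shiftProduct_left φ ψ a)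
    (fun u => (hasDerivAt_shiftProduct φ ψ u a).differentiableAt)
    (by rw [hd]; exact (integrable_shiftProduct_left _ _ a).add (integrable_shiftProduct_left _ _ a))
  rw [hd] at h
  rw [h]
  simp
theorem sqrtTwoFourier_add {f g : ℝ → ℂ} (hf : Integrable f) (hg : Integrable g) (b : ℝ) :
    sqrtTwoFourier (fun u => f u + g u) b = sqrtTwoFourier f b + sqrtTwoFourier g b := by
  simp only [sqrtTwoFourier, mul_add]
  exact integral_add (integrable_phase_mul hf (by fun_prop)) (integrable_phase_mul hg (by fun_prop))

theorem norm_sqrtTwoFourier_le (f : ℝ → ℂ) (b : ℝ) : ‖sqrtTwoFourier f b‖ ≤ ∫ u, ‖f u‖ := by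
  refine (norm_integral_le_integral_norm _).trans_eq ?_
  simp

/-- The Fourier transform of a shifted product, which is the ambiguity function up to
normalisation. -/
def ambiguity (φ ψ : 𝓢(ℝ, ℂ)) (a b : ℝ) : ℂ := sqrtTwoFourier (fun u => shiftProduct φ ψ u a) b

/-- Integration by parts: a factor b costs one derivative on `φ` or `ψ`. -/
theorem ambiguity_deriv (φ ψ : 𝓢(ℝ, ℂ)) (a b : ℝ) :
    ambiguity (SchwartzMap.derivCLM ℂ ℂ φ) ψ a b + ambiguity φ (SchwartzMap.derivCLM ℂ ℂ ψ) a b =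
      Complex.I * (√2 * b : ℝ) * ambiguity φ ψ a b := by
  unfold ambiguity
  rw [← sqrtTwoFourier_add (integrable_shiftProduct_left _ _ a)
    (integrable_shiftProduct_left _ _ a), sqrtTwoFourier_eq_fourier,
    norm_fourier_shiftProduct_deriv, sqrtTwoFourier_eq_fourier]
  congr 1
  have : (Real.pi : ℂ) ≠ 0 := by exact_mod_cast Real.pi_ne_zero
  push_cast
  field_simp

/-- Two integrations by parts give decay of order b⁻². The coefficient is built from L¹ norms in u
of shifted products, which are integrable in a. -/
theorem exists_ambiguity_bound (φ ψ : 𝓢(ℝ, ℂ)) :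
    ∃ H : ℝ → ℝ, Integrable H ∧ ∀ a b, ‖ambiguity φ ψ a b‖ ≤ H a * (1 + b ^ 2)⁻¹ := by
  let D : 𝓢(ℝ, ℂ) → 𝓢(ℝ, ℂ) := SchwartzMap.derivCLM ℂ ℂ
  let N : 𝓢(ℝ, ℂ) → 𝓢(ℝ, ℂ) → ℝ → ℝ := fun φ ψ a => ∫ u, ‖shiftProduct φ ψ u a‖
  have hN : ∀ φ ψ : 𝓢(ℝ, ℂ), Integrable (N φ ψ) := fun φ ψ =>
    (integrable_shiftProduct φ ψ).norm.integral_prod_right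
  have hNb : ∀ (φ ψ : 𝓢(ℝ, ℂ)) a b, ‖ambiguity φ ψ a b‖ ≤ N φ ψ a := fun φ ψ a b =>
    norm_sqrtTwoFourier_le _ _
  refine ⟨fun a => N φ ψ a + (N (D (D φ)) ψ a + N (D φ) (D ψ) a + (N (D φ) (D ψ) a +
    N φ (D (D ψ)) a)), (hN _ _).add (((hN _ _).add (hN _ _)).add ((hN _ _).add (hN _ _))),
    fun a b => ?_⟩
  rw [← div_eq_mul_inv, le_div_iff₀ (by positivity)]
  have h1 := ambiguity_deriv φ ψ a b
  have h2 := ambiguity_deriv (D φ) ψ a b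
  have h3 := ambiguity_deriv φ (D ψ) a b
  have h4 : ((2 * b ^ 2 : ℝ) : ℂ) * ambiguity φ ψ a b =
      -(ambiguity (D (D φ)) ψ a b + ambiguity (D φ) (D ψ) a b + (ambiguity (D φ) (D ψ) a b +
        ambiguity φ (D (D ψ)) a b)) := by
    rw [h2, h3, ← mul_add, h1]
    have hs : ((√2 : ℝ) : ℂ) ^ 2 = 2 := by exact_mod_cast Real.sq_sqrt (by norm_num : (0:ℝ) ≤ 2)
    push_cast
    linear_combination ((b : ℂ) ^ 2 * ambiguity φ ψ a b) * (Complex.I ^ 2 * hs + 2 * Complex.I_sq)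
  have h5 : 2 * b ^ 2 * ‖ambiguity φ ψ a b‖ ≤ N (D (D φ)) ψ a + N (D φ) (D ψ) a +
      (N (D φ) (D ψ) a + N φ (D (D ψ)) a) := by
    have := congrArg norm h4
    rw [norm_mul, Complex.norm_real, Real.norm_of_nonneg (by positivity), norm_neg] at this
    rw [this]
    refine (norm_add_le _ _).trans (add_le_add ((norm_add_le _ _).trans (add_le_add ?_ ?_))
      ((norm_add_le _ _).trans (add_le_add ?_ ?_))) <;> exact hNb _ _ _ _
  have h6 := hNb φ ψ a b
  nlinarith [mul_nonneg (sq_nonneg b) (norm_nonneg (ambiguity φ ψ a b))]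

theorem integrable_sqrtTwoFourier_shiftProduct (φ ψ : 𝓢(ℝ, ℂ)) (a : ℝ) :
    Integrable (sqrtTwoFourier fun u => shiftProduct φ ψ u a) := by
  obtain ⟨H, -, hH⟩ := exists_ambiguity_bound φ ψ
  refine Integrable.mono' (integrable_inv_one_add_sq.const_mul (H a)) ?_ (ae_of_all _ (hH a))
  have : sqrtTwoFourier (fun u => shiftProduct φ ψ u a) = fun b =>
      (𝓕 fun u => shiftProduct φ ψ u a) (√2 / (2 * Real.pi) * b) :=
    funext fun b => sqrtTwoFourier_eq_fourier _ _
  rw [this]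
  exact ((continuous_fourier_of_integrable (integrable_shiftProduct_left φ ψ a)).comp
    (by fun_prop)).aestronglyMeasurable

theorem measurable_ambiguity (φ ψ : 𝓢(ℝ, ℂ)) :
    Measurable fun z : ℝ × ℝ => ambiguity φ ψ z.1 z.2 := by
  refine StronglyMeasurable.measurable ?_
  refine StronglyMeasurable.integral_prod_right (f := fun (z : ℝ × ℝ) (u : ℝ) =>
    phase (-(√2 * z.2) * u) * shiftProduct φ ψ u z.1) (Measurable.stronglyMeasurable ?_)
  have h := (measurable_shiftProduct φ ψ).comp
    (by fun_prop : Measurable fun p : (ℝ × ℝ) × ℝ => (p.2, p.1.1))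
  exact (by fun_prop : Measurable fun p : (ℝ × ℝ) × ℝ => phase (-(√2 * p.1.2) * p.2)).mul h

theorem integrable_ambiguity (φ ψ : 𝓢(ℝ, ℂ)) :
    Integrable fun z : ℝ × ℝ => ambiguity φ ψ z.1 z.2 := by
  obtain ⟨H, hH, hb⟩ := exists_ambiguity_bound φ ψ
  exact Integrable.mono' (hH.mul_prod integrable_inv_one_add_sq)
    (measurable_ambiguity φ ψ).aestronglyMeasurable (ae_of_all _ fun z => hb z.1 z.2)

/-! ### Interchanging the transforms -/

theorem quadTransform_const_mul (C : ℂ) (p q r : ℝ) (c : ℂ) (f : ℝ → ℂ) (x : ℝ) :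
    quadTransform C p q r (fun y => c * f y) x = c * quadTransform C p q r f x := by
  have : ∀ y, phase (q * y ^ 2 + r * x * y) * (c * f y) =
      c * (phase (q * y ^ 2 + r * x * y) * f y) := fun y => by ring
  simp only [quadTransform, this, integral_const_mul]
  ring

theorem fracFourier_const_mul (θ : ℝ) (c : ℂ) (f : ℝ → ℂ) (x : ℝ) :
    fracFourier θ (fun y => c * f y) x = c * fracFourier θ f x := by
  by_cases h : Real.sin θ = 0
  · simp only [fracFourier_of_sin_eq_zero h]
  · simp only [fracFourier_of_sin_ne_zero h, quadTransform_const_mul]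

theorem quadTransform_quadTransform_swap {F : ℝ → ℝ → ℂ}
    (hF : Integrable (fun z : ℝ × ℝ => F z.1 z.2)) (C C' : ℂ) (p q r p' q' r' x y : ℝ) :
    quadTransform C p q r (fun a => quadTransform C' p' q' r' (fun u => F u a) x) y =
      quadTransform C' p' q' r' (fun u => quadTransform C p q r (F u) y) x := by
  have hG : Integrable (fun z : ℝ × ℝ =>
      phase (q * z.2 ^ 2 + r * y * z.2 + (q' * z.1 ^ 2 + r' * x * z.1)) * F z.1 z.2) :=
    integrable_phase_mul hF (by fun_prop)
  have hswap := integral_integral_swap (f := fun u a : ℝ =>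
      phase (q * a ^ 2 + r * y * a + (q' * u ^ 2 + r' * x * u)) * F u a) hG
  have e1 : ∀ a, phase (q * a ^ 2 + r * y * a) * quadTransform C' p' q' r' (fun u => F u a) x =
      C' * phase (p' * x ^ 2) *
        ∫ u, phase (q * a ^ 2 + r * y * a + (q' * u ^ 2 + r' * x * u)) * F u a := by
    intro a
    simp only [phase_add, quadTransform, ← integral_const_mul]
    congr 1; ext u; ring
  have e2 : ∀ u, phase (q' * u ^ 2 + r' * x * u) * quadTransform C p q r (F u) y =
      C * phase (p * y ^ 2) *
        ∫ a, phase (q * a ^ 2 + r * y * a + (q' * u ^ 2 + r' * x * u)) * F u a := by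
    intro u
    simp only [phase_add, quadTransform, ← integral_const_mul]
    congr 1; ext a; ring
  rw [quadTransform]
  simp only [e1]
  rw [integral_const_mul, ← hswap]
  conv_rhs => rw [quadTransform]
  simp only [e2]
  rw [integral_const_mul]
  ring

theorem fracFourier_quadTransform_swap {F : ℝ → ℝ → ℂ}
    (hF : Integrable (fun z : ℝ × ℝ => F z.1 z.2)) (θ : ℝ) (C : ℂ) (p q r x y : ℝ) :
    fracFourier θ (fun a => quadTransform C p q r (fun u => F u a) x) y =
      quadTransform C p q r (fun u => fracFourier θ (F u) y) x := by
  by_cases h : Real.sin θ = 0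
  · simp only [fracFourier_of_sin_eq_zero h]
  · simp only [fracFourier_of_sin_ne_zero h]
    exact quadTransform_quadTransform_swap hF ..

theorem fracFourier_fracFourier_swap {F : ℝ → ℝ → ℂ}
    (hF : Integrable (fun z : ℝ × ℝ => F z.1 z.2)) (θ θ' x y : ℝ) :
    fracFourier θ (fun a => fracFourier θ' (fun u => F u a) x) y =
      fracFourier θ' (fun u => fracFourier θ (F u) y) x := by
  by_cases h : Real.sin θ' = 0
  · simp only [fracFourier_of_sin_eq_zero h]
  · simp only [fracFourier_of_sin_ne_zero h]
    exact fracFourier_quadTransform_swap hF ..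

/-! ### The matrix elements of the bifractional displacement operators -/

/-- The double transform of the ambiguity function which gives the matrix elements of
`U(α,β;θ₁,θ₂)` up to the factor `|cos(θ₁-θ₂)|^{1/2}`. -/
def bifracElement (θ₁ θ₂ : ℝ) (φ ψ : 𝓢(ℝ, ℂ)) (α β : ℝ) : ℂ :=
  fracFourier θ₂ (fun a => fracFourier θ₁ (ambiguity φ ψ a) α) β

theorem isBifractional_iff {α β θ₁ θ₂ : ℝ} {U : StateSpace →L[ℂ] StateSpace} :
    IsBifractional α β θ₁ θ₂ U ↔ ∀ φ ψ : 𝓢(ℝ, ℂ),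
      inner ℂ (φ.toLp 2 volume) (U (ψ.toLp 2 volume)) =
        (√|Real.cos (θ₁ - θ₂)| : ℂ) * bifracElement θ₁ θ₂ φ ψ α β := by
  have e : ∀ (φ ψ : 𝓢(ℝ, ℂ)) a, (fun b => displacementElement φ ψ a (-b)) = ambiguity φ ψ a :=
    fun φ ψ a => funext fun b => displacementElement_neg φ ψ a b
  simp only [IsBifractional, e, bifracElement]

/-- The transform in the second variable of a shifted product. -/
def slicedElement (θ : ℝ) (φ ψ : 𝓢(ℝ, ℂ)) (β u : ℝ) : ℂ := fracFourier θ (shiftProduct φ ψ u) β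

/-- The Fresnel computation for each a, followed by Fubini. `C` and `p` do not depend on `φ` and
`ψ`, so the same transform acts on every term of a series. -/
theorem exists_bifracElement_eq_quadTransform {θ₁ : ℝ} (hc : Real.cos θ₁ ≠ 0) (θ₂ : ℝ) :
    ∃ (C : ℂ) (p : ℝ), ‖C‖ ^ 2 = |Real.cos θ₁|⁻¹ ∧ ∀ (φ ψ : 𝓢(ℝ, ℂ)) (α β : ℝ),
      bifracElement θ₁ θ₂ φ ψ α β =
        quadTransform C p (Real.tan θ₁) (-(√2 / Real.cos θ₁)) (slicedElement θ₂ φ ψ β) α := by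
  obtain ⟨C, p, hC, h⟩ := exists_fracFourier_sqrtTwoFourier_eq_quadTransform hc
  refine ⟨C, p, hC, fun φ ψ α β => ?_⟩
  have e : ∀ a, fracFourier θ₁ (ambiguity φ ψ a) α = quadTransform C p (Real.tan θ₁)
      (-(√2 / Real.cos θ₁)) (fun u => shiftProduct φ ψ u a) α := fun a =>
    h _ (integrable_shiftProduct_left φ ψ a) (integrable_sqrtTwoFourier_shiftProduct φ ψ a) α
  simp only [bifracElement, e]
  exact fracFourier_quadTransform_swap (integrable_shiftProduct φ ψ) ..

theorem exists_bifracElement_eq_eval {θ₁ : ℝ} (hc : Real.cos θ₁ = 0) (θ₂ : ℝ) :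
    ∃ C : ℂ, ‖C‖ ^ 2 = Real.pi ∧ ∀ (φ ψ : 𝓢(ℝ, ℂ)) (α β : ℝ),
      bifracElement θ₁ θ₂ φ ψ α β = C * slicedElement θ₂ φ ψ β (Real.sin θ₁ / √2 * α) := by
  obtain ⟨C, hC, h⟩ := exists_fracFourier_sqrtTwoFourier_eq_eval hc
  refine ⟨C, hC, fun φ ψ α β => ?_⟩
  have e : ∀ a, fracFourier θ₁ (ambiguity φ ψ a) α =
      C * shiftProduct φ ψ (Real.sin θ₁ / √2 * α) a := fun a =>
    h _ (continuous_shiftProduct_left φ ψ a) (integrable_shiftProduct_left φ ψ a)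
      (integrable_sqrtTwoFourier_shiftProduct φ ψ a) α
  simp only [bifracElement, e]
  exact fracFourier_const_mul ..

/-! ### Boundedness of the matrix elements -/

/-- The phases in one variable alone are harmless. The cross term κst is a Fourier kernel, bounded
on L² by Plancherel as soon as κ ≠ 0, and Cauchy–Schwarz finishes. -/
theorem norm_integral_quadratic_le {A B B' κ : ℝ} (hκ : κ ≠ 0) (φ ψ : 𝓢(ℝ, ℂ)) :
    ‖∫ z : ℝ × ℝ, phase (A * z.1 ^ 2 + B * z.1 + (A * z.2 ^ 2 + κ * z.1 * z.2) + B' * z.2) *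
      (conj (φ z.1) * ψ z.2)‖ ≤ √(2 * Real.pi / |κ|) * (normL2 φ * normL2 ψ) := by
  have hint : Integrable (fun z : ℝ × ℝ => conj (φ z.1) * ψ z.2) (volume.prod volume) :=
    ((Complex.conjCLE : ℂ →L[ℝ] ℂ).integrable_comp φ.integrable).mul_prod ψ.integrable
  have hint2 := integrable_phase_mul hint (g := fun z : ℝ × ℝ =>
    A * z.1 ^ 2 + B * z.1 + (A * z.2 ^ 2 + κ * z.1 * z.2) + B' * z.2) (by fun_prop)
  let g : ℝ → ℂ := fun t => phase (B' * t) * ψ t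
  have hg : Integrable g := integrable_phase_mul ψ.integrable (by fun_prop)
  have hgm : Measurable g := by
    have := ψ.continuous
    fun_prop
  let Q : ℝ → ℂ := quadTransform 1 0 A κ g
  have hQm : Measurable Q := measurable_quadTransform _ _ _ _ hgm
  have e : ∫ z : ℝ × ℝ, phase (A * z.1 ^ 2 + B * z.1 + (A * z.2 ^ 2 + κ * z.1 * z.2) + B' * z.2) *
      (conj (φ z.1) * ψ z.2) = ∫ s, phase (A * s ^ 2 + B * s) * (conj (φ s) * Q s) := by
    rw [Measure.volume_eq_prod, integral_prod _ hint2]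
    refine integral_congr_ae (ae_of_all _ fun s => ?_)
    simp only [Q, quadTransform, g, zero_mul, phase_zero, mul_one, one_mul, phase_add,
      ← integral_const_mul]
    refine integral_congr_ae (ae_of_all _ fun t => ?_)
    simp only []
    ring
  rw [e]
  have hφm : Measurable φ := φ.continuous.measurable
  have hle : ∫⁻ s, ‖φ s‖ₑ * ‖Q s‖ₑ ≤
      ENNReal.ofReal (normL2 φ * (√(2 * Real.pi / |κ|) * normL2 ψ)) := by
    refine lintegral_enorm_mul_le_of_sq hφm hQm (norm_nonneg _)
      (lintegral_enorm_sq_schwartz φ).le ?_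
    rw [lintegral_quadTransform _ _ _ hκ hg]
    simp only [g, enorm_mul, enorm_phase, one_mul, norm_one, one_pow]
    rw [lintegral_enorm_sq_schwartz, ← ENNReal.ofReal_pow (norm_nonneg _),
      ← ENNReal.ofReal_mul (by positivity), ← ENNReal.ofReal_pow (by positivity), mul_pow,
      Real.sq_sqrt (by positivity)]
  refine (norm_integral_le_lintegral_norm _).trans ?_
  refine ENNReal.toReal_le_of_le_ofReal (by positivity) ?_
  refine (lintegral_mono fun s => ?_).trans (hle.trans_eq (by congr 1; ring))
  rw [ofReal_norm, enorm_mul, enorm_phase, one_mul, enorm_mul]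
  simp [← ofReal_norm]

theorem norm_slicedElement_le {θ : ℝ} (hs : Real.sin θ ≠ 0) (φ ψ : 𝓢(ℝ, ℂ)) (β u : ℝ) :
    ‖slicedElement θ φ ψ β u‖ ≤ ‖fracConst θ‖ * √2 * (normL2 φ * normL2 ψ) := by
  rw [slicedElement, fracFourier_of_sin_ne_zero hs, mul_assoc]
  refine (norm_quadTransform_le ..).trans ?_
  gcongr
  exact integral_norm_shiftProduct_right_le φ ψ u

theorem integrable_slicedElement (θ : ℝ) (φ ψ : 𝓢(ℝ, ℂ)) (β : ℝ) :
    Integrable (slicedElement θ φ ψ β) := by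
  by_cases hs : Real.sin θ = 0
  · have e : slicedElement θ φ ψ β = fun u => shiftProduct φ ψ u (Real.cos θ * β) :=
      funext fun u => fracFourier_of_sin_eq_zero hs _ _
    rw [e]
    exact integrable_shiftProduct_left φ ψ _
  · have e : slicedElement θ φ ψ β = fun u => quadTransform (fracConst θ) (-(Real.cot θ / 2))
        (-(Real.cot θ / 2)) (Real.sin θ)⁻¹ (shiftProduct φ ψ u) β :=
      funext fun u => fracFourier_of_sin_ne_zero hs _ _
    rw [e]
    unfold quadTransform
    refine Integrable.const_mul ?_ _
    have := integrable_phase_mul (integrable_shiftProduct φ ψ) (g := fun z : ℝ × ℝ =>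
      -(Real.cot θ / 2) * z.2 ^ 2 + (Real.sin θ)⁻¹ * β * z.2) (by fun_prop)
    exact this.integral_prod_left

theorem measurable_slicedElement (θ : ℝ) (φ ψ : 𝓢(ℝ, ℂ)) :
    Measurable fun z : ℝ × ℝ => slicedElement θ φ ψ z.1 z.2 := by
  by_cases hs : Real.sin θ = 0
  · simp only [slicedElement, fracFourier_of_sin_eq_zero hs]
    exact (measurable_shiftProduct φ ψ).comp (by fun_prop : Measurable fun z : ℝ × ℝ =>
      (z.2, Real.cos θ * z.1))
  · simp only [slicedElement, fracFourier_of_sin_ne_zero hs]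
    unfold quadTransform
    refine (by fun_prop : Measurable fun z : ℝ × ℝ =>
      fracConst θ * phase (-(Real.cot θ / 2) * z.1 ^ 2)).mul ?_
    refine StronglyMeasurable.measurable ?_
    refine StronglyMeasurable.integral_prod_right (f := fun (z : ℝ × ℝ) (a : ℝ) =>
      phase (-(Real.cot θ / 2) * a ^ 2 + (Real.sin θ)⁻¹ * z.1 * a) * shiftProduct φ ψ z.2 a)
      (Measurable.stronglyMeasurable ?_)
    have h := (measurable_shiftProduct φ ψ).comp
      (by fun_prop : Measurable fun p : (ℝ × ℝ) × ℝ => (p.1.2, p.2))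
    exact (by fun_prop : Measurable fun p : (ℝ × ℝ) × ℝ =>
      phase (-(Real.cot θ / 2) * p.2 ^ 2 + (Real.sin θ)⁻¹ * p.1.1 * p.2)).mul h

theorem measurable_bifracElement (θ₁ θ₂ : ℝ) (φ ψ : 𝓢(ℝ, ℂ)) :
    Measurable fun z : ℝ × ℝ => bifracElement θ₁ θ₂ φ ψ z.1 z.2 := by
  by_cases hc : Real.cos θ₁ = 0
  · obtain ⟨C, -, h⟩ := exists_bifracElement_eq_eval hc θ₂
    simp only [h]
    exact ((measurable_slicedElement θ₂ φ ψ).comp (by fun_prop : Measurable fun z : ℝ × ℝ =>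
      (z.2, Real.sin θ₁ / √2 * z.1))).const_mul C
  · obtain ⟨C, p, -, h⟩ := exists_bifracElement_eq_quadTransform hc θ₂
    simp only [h]
    unfold quadTransform
    refine (by fun_prop : Measurable fun z : ℝ × ℝ => C * phase (p * z.1 ^ 2)).mul ?_
    refine StronglyMeasurable.measurable ?_
    refine StronglyMeasurable.integral_prod_right (f := fun (z : ℝ × ℝ) (u : ℝ) =>
      phase (Real.tan θ₁ * u ^ 2 + -(√2 / Real.cos θ₁) * z.1 * u) * slicedElement θ₂ φ ψ z.2 u)
      (Measurable.stronglyMeasurable ?_)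
    have h := (measurable_slicedElement θ₂ φ ψ).comp
      (by fun_prop : Measurable fun p : (ℝ × ℝ) × ℝ => (p.1.2, p.2))
    exact (by fun_prop : Measurable fun p : (ℝ × ℝ) × ℝ =>
      phase (Real.tan θ₁ * p.2 ^ 2 + -(√2 / Real.cos θ₁) * p.1.1 * p.2)).mul h

/-- Written out, this is a double oscillatory integral. In the coordinates s = u + a/√2, t = u -
a/√2 the test functions separate and the phase acquires the cross term κst with κ = cos(θ₁-θ₂)/(2
cos θ₁ sin θ₂), which is nonzero. -/
theorem exists_norm_quadTransform_slicedElement_le {θ₁ θ₂ : ℝ} (hc : Real.cos θ₁ ≠ 0)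
    (hs : Real.sin θ₂ ≠ 0) (h : Real.cos (θ₁ - θ₂) ≠ 0) (C : ℂ) (p : ℝ) :
    ∃ K : ℝ, ∀ (φ ψ : 𝓢(ℝ, ℂ)) (α β : ℝ),
      ‖quadTransform C p (Real.tan θ₁) (-(√2 / Real.cos θ₁)) (slicedElement θ₂ φ ψ β) α‖ ≤
        K * (normL2 φ * normL2 ψ) := by
  set q₁ := Real.tan θ₁ with hq₁
  set q₂ := -(Real.cot θ₂ / 2) with hq₂
  -- The coefficient of st in q₁u² + q₂a², where u = (s+t)/2 and a = (s-t)/√2.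
  set κ : ℝ := q₁ / 2 - q₂ with hκ'
  have hκ : κ ≠ 0 := by
    have e : κ = Real.cos (θ₁ - θ₂) / (2 * Real.cos θ₁ * Real.sin θ₂) := by
      rw [hκ', hq₁, hq₂, Real.tan_eq_sin_div_cos, Real.cot_eq_cos_div_sin, Real.cos_sub]
      field_simp
      ring
    rw [e]
    exact div_ne_zero h (mul_ne_zero (mul_ne_zero two_ne_zero hc) hs)
  refine ⟨‖C‖ * ‖fracConst θ₂‖ * √2 * √(2 * Real.pi / |κ|), fun φ ψ α β => ?_⟩
  set r₁ := -(√2 / Real.cos θ₁)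
  set r₂ := (Real.sin θ₂)⁻¹
  have h2 : √2 * √2 = 2 := Real.mul_self_sqrt (by norm_num)
  have h20 : √2 ≠ 0 := by positivity
  have hG : Integrable (fun z : ℝ × ℝ => phase (q₁ * z.1 ^ 2 + r₁ * α * z.1 +
      (q₂ * z.2 ^ 2 + r₂ * β * z.2)) * shiftProduct φ ψ z.1 z.2) :=
    integrable_phase_mul (integrable_shiftProduct φ ψ) (by fun_prop)
  have e : quadTransform C p q₁ r₁ (slicedElement θ₂ φ ψ β) α =
      C * phase (p * α ^ 2) * (fracConst θ₂ * phase (q₂ * β ^ 2)) * ∫ z : ℝ × ℝ,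
        phase (q₁ * z.1 ^ 2 + r₁ * α * z.1 + (q₂ * z.2 ^ 2 + r₂ * β * z.2)) *
          shiftProduct φ ψ z.1 z.2 := by
    rw [Measure.volume_eq_prod, integral_prod _ hG, quadTransform, mul_assoc _ (_ * _),
      ← integral_const_mul (fracConst θ₂ * _)]
    congr 1
    refine integral_congr_ae (ae_of_all _ fun u => ?_)
    simp only [slicedElement]
    rw [fracFourier_of_sin_ne_zero hs, quadTransform]
    simp only [phase_add, ← integral_const_mul]
    refine integral_congr_ae (ae_of_all _ fun a => ?_)
    simp only []
    ring
  let F : ℝ × ℝ → ℂ := fun z =>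
    phase ((q₁ / 4 + q₂ / 2) * z.1 ^ 2 + (r₁ * α / 2 + r₂ * β / √2) * z.1 +
      ((q₁ / 4 + q₂ / 2) * z.2 ^ 2 + κ * z.1 * z.2) + (r₁ * α / 2 - r₂ * β / √2) * z.2) *
        (conj (φ z.1) * ψ z.2)
  have e2 : ∀ z : ℝ × ℝ, phase (q₁ * z.1 ^ 2 + r₁ * α * z.1 + (q₂ * z.2 ^ 2 + r₂ * β * z.2)) *
        shiftProduct φ ψ z.1 z.2 = F (diagonalEquiv z) := by
    rintro ⟨u, a⟩
    simp only [F, diagonalEquiv_apply, shiftProduct]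
    congr 2
    rw [hκ']
    field_simp
    ring_nf
    rw [show √2 ^ 2 = 2 by rw [sq, h2]]
    ring
  rw [e, integral_congr_ae (ae_of_all _ e2), integral_comp_diagonalEquiv F, norm_mul, norm_mul, norm_mul, norm_mul, norm_mul, norm_phase,
    norm_phase, mul_one, mul_one]
  have h5 := norm_integral_quadratic_le (A := q₁ / 4 + q₂ / 2) (B := r₁ * α / 2 + r₂ * β / √2)
    (B' := r₁ * α / 2 - r₂ * β / √2) hκ φ ψ
  have h6 : ‖(((√2)⁻¹ : ℝ) : ℂ)‖ ≤ √2 := by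
    rw [Complex.norm_real, Real.norm_of_nonneg (by positivity)]
    refine inv_le_of_inv_le₀ (by positivity) ?_
    have : (1 : ℝ) ≤ √2 := Real.one_le_sqrt.2 (by norm_num)
    exact (inv_le_one_of_one_le₀ this).trans this
  calc _ ≤ ‖C‖ * ‖fracConst θ₂‖ * (√2 * (√(2 * Real.pi / |κ|) * (normL2 φ * normL2 ψ))) := by
        gcongr
    _ = _ := by ring

/-- If cos θ₁ = 0 then sin θ₂ ≠ 0. When cos θ₁ = 0 or sin θ₂ = 0 one transform is an evaluation, and
an L¹ bound on a single slice suffices; otherwise the oscillation is needed. -/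
theorem exists_norm_bifracElement_le {θ₁ θ₂ : ℝ} (h : Real.cos (θ₁ - θ₂) ≠ 0) :
    ∃ K : ℝ, ∀ (φ ψ : 𝓢(ℝ, ℂ)) (α β : ℝ),
      ‖bifracElement θ₁ θ₂ φ ψ α β‖ ≤ K * (normL2 φ * normL2 ψ) := by
  by_cases hc : Real.cos θ₁ = 0
  · have hs : Real.sin θ₂ ≠ 0 := fun hs => h (by rw [Real.cos_sub, hc, hs]; ring)
    obtain ⟨C, -, hC⟩ := exists_bifracElement_eq_eval hc θ₂
    refine ⟨‖C‖ * (‖fracConst θ₂‖ * √2), fun φ ψ α β => ?_⟩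
    rw [hC, norm_mul, mul_assoc]
    gcongr
    exact norm_slicedElement_le hs ..
  · obtain ⟨C, p, -, hC⟩ := exists_bifracElement_eq_quadTransform hc θ₂
    simp only [hC]
    by_cases hs : Real.sin θ₂ = 0
    · refine ⟨‖C‖, fun φ ψ α β => (norm_quadTransform_le ..).trans ?_⟩
      gcongr
      simp only [slicedElement, fracFourier_of_sin_eq_zero hs]
      exact integral_norm_shiftProduct_left_le ..
    · exact exists_norm_quadTransform_slicedElement_le hc hs h C p

/-! ### Existence of the bifractional displacement operators -/

theorem denseRange_schwartz_toLp : DenseRange fun ψ : 𝓢(ℝ, ℂ) => ψ.toLp 2 volume :=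
  SchwartzMap.denseRange_toLpCLM (F := ℂ) (E := ℝ) (μ := volume) (p := 2) (by simp)

/-- A bounded sesquilinear form on Schwartz functions is given by a bounded operator. -/
theorem exists_operator_of_sesq_bound (B : 𝓢(ℝ, ℂ) → 𝓢(ℝ, ℂ) → ℂ)
    (add_left : ∀ φ φ' ψ, B (φ + φ') ψ = B φ ψ + B φ' ψ)
    (smul_left : ∀ (c : ℂ) φ ψ, B (c • φ) ψ = conj c * B φ ψ)
    (add_right : ∀ φ ψ ψ', B φ (ψ + ψ') = B φ ψ + B φ ψ')
    (smul_right : ∀ (c : ℂ) φ ψ, B φ (c • ψ) = c * B φ ψ)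
    (K : ℝ) (hK : ∀ φ ψ, ‖B φ ψ‖ ≤ K * (normL2 φ * normL2 ψ)) :
    ∃ U : StateSpace →L[ℂ] StateSpace, ∀ φ ψ : 𝓢(ℝ, ℂ),
      inner ℂ (φ.toLp 2 volume) (U (ψ.toLp 2 volume)) = B φ ψ := by
  let e : 𝓢(ℝ, ℂ) →ₗ[ℂ] StateSpace := (SchwartzMap.toLpCLM ℂ ℂ 2 volume).toLinearMap
  have he : DenseRange e := denseRange_schwartz_toLp
  have hee : ∀ φ, e φ = φ.toLp 2 volume := fun φ => rfl
  let L : 𝓢(ℝ, ℂ) → 𝓢(ℝ, ℂ) →ₗ[ℂ] ℂ := fun φ =>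
    { toFun := B φ, map_add' := add_right φ, map_smul' := fun c ψ => smul_right c φ ψ }
  have hL : ∀ φ ψ, ‖L φ ψ‖ ≤ (K * normL2 φ) * ‖e ψ‖ := fun φ ψ => by
    rw [mul_assoc]; exact hK φ ψ
  -- The form is extended by continuity first in the right argument, then in the left one, where it
  -- is conjugate linear.
  let E : 𝓢(ℝ, ℂ) → StateSpace →L[ℂ] ℂ := fun φ => (L φ).extendOfNorm e
  have hE : ∀ φ ψ, E φ (e ψ) = B φ ψ := fun φ ψ =>
    LinearMap.extendOfNorm_eq he ⟨_, hL φ⟩ ψ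
  have hext : ∀ f g : StateSpace →L[ℂ] ℂ, (∀ ψ, f (e ψ) = g (e ψ)) → f = g := fun f g h =>
    DFunLike.coe_injective (he.equalizer f.continuous g.continuous (funext h))
  let M : 𝓢(ℝ, ℂ) →ₗ⋆[ℂ] (StateSpace →L[ℂ] ℂ) :=
    { toFun := E
      map_add' := fun φ φ' => hext _ _ fun ψ => by
        rw [hE, _root_.add_apply, hE, hE, add_left]
      map_smul' := fun c φ => hext _ _ fun ψ => by
        rw [hE, _root_.smul_apply, hE, smul_left, smul_eq_mul] }
  have hM : ∀ φ, ‖M φ‖ ≤ |K| * ‖e φ‖ := fun φ => by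
    refine ContinuousLinearMap.opNorm_le_bound _ (by positivity) fun f => ?_
    refine LinearMap.norm_extendOfNorm_apply_le he _ (fun ψ => (hL φ ψ).trans ?_) f
    gcongr
    · exact le_abs_self K
    · exact le_of_eq rfl
  let G : StateSpace →L⋆[ℂ] StateSpace →L[ℂ] ℂ := M.extendOfNorm e
  have hG : ∀ φ, G (e φ) = E φ := fun φ => LinearMap.extendOfNorm_eq he ⟨_, hM⟩ φ
  -- The Riesz operator of `G` acts on the left argument of the inner product; its adjoint acts on
  -- the right.
  refine ⟨ContinuousLinearMap.adjoint (InnerProductSpace.continuousLinearMapOfBilin G),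
    fun φ ψ => ?_⟩
  rw [ContinuousLinearMap.adjoint_inner_right,
    InnerProductSpace.continuousLinearMapOfBilin_apply, ← hee, ← hee, hG, hE]

theorem quadTransform_add {f g : ℝ → ℂ} (hf : Integrable f) (hg : Integrable g)
    (C : ℂ) (p q r x : ℝ) : quadTransform C p q r (fun y => f y + g y) x =
      quadTransform C p q r f x + quadTransform C p q r g x := by
  simp only [quadTransform, mul_add]
  rw [integral_add (integrable_phase_mul hf (by fun_prop)) (integrable_phase_mul hg (by fun_prop)),
    mul_add]

theorem fracFourier_add {f g : ℝ → ℂ} (hf : Integrable f) (hg : Integrable g) (θ x : ℝ) :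
    fracFourier θ (fun y => f y + g y) x = fracFourier θ f x + fracFourier θ g x := by
  by_cases h : Real.sin θ = 0
  · simp only [fracFourier_of_sin_eq_zero h]
  · simp only [fracFourier_of_sin_ne_zero h, quadTransform_add hf hg]

theorem slicedElement_add_left (θ : ℝ) (φ φ' ψ : 𝓢(ℝ, ℂ)) (β : ℝ) :
    slicedElement θ (φ + φ') ψ β = fun u => slicedElement θ φ ψ β u + slicedElement θ φ' ψ β u := by
  ext u
  simp only [slicedElement]
  rw [← fracFourier_add (integrable_shiftProduct_right φ ψ u)
    (integrable_shiftProduct_right φ' ψ u)]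
  congr 1
  ext a
  simp [shiftProduct, add_mul]

theorem slicedElement_add_right (θ : ℝ) (φ ψ ψ' : 𝓢(ℝ, ℂ)) (β : ℝ) :
    slicedElement θ φ (ψ + ψ') β = fun u => slicedElement θ φ ψ β u + slicedElement θ φ ψ' β u := by
  ext u
  simp only [slicedElement]
  rw [← fracFourier_add (integrable_shiftProduct_right φ ψ u)
    (integrable_shiftProduct_right φ ψ' u)]
  congr 1
  ext a
  simp [shiftProduct, mul_add]

theorem slicedElement_smul_left (θ : ℝ) (c : ℂ) (φ ψ : 𝓢(ℝ, ℂ)) (β : ℝ) :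
    slicedElement θ (c • φ) ψ β = fun u => conj c * slicedElement θ φ ψ β u := by
  ext u
  simp only [slicedElement]
  rw [← fracFourier_const_mul]
  congr 1
  ext a
  simp [shiftProduct, mul_assoc]

theorem slicedElement_smul_right (θ : ℝ) (c : ℂ) (φ ψ : 𝓢(ℝ, ℂ)) (β : ℝ) :
    slicedElement θ φ (c • ψ) β = fun u => c * slicedElement θ φ ψ β u := by
  ext u
  simp only [slicedElement]
  rw [← fracFourier_const_mul]
  congr 1
  ext a
  simp [shiftProduct, mul_left_comm]

/-- Merges the two cases of cos θ₁, so that sesquilinearity need be checked only for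
`slicedElement`. -/
theorem exists_bifracElement_eq_linear (θ₁ θ₂ α : ℝ) :
    ∃ T : (ℝ → ℂ) → ℂ, (∀ f g, Integrable f → Integrable g →
        T (fun u => f u + g u) = T f + T g) ∧ (∀ (c : ℂ) f, T (fun u => c * f u) = c * T f) ∧
      ∀ (φ ψ : 𝓢(ℝ, ℂ)) (β : ℝ), bifracElement θ₁ θ₂ φ ψ α β = T (slicedElement θ₂ φ ψ β) := by
  by_cases hc : Real.cos θ₁ = 0
  · obtain ⟨C, -, h⟩ := exists_bifracElement_eq_eval hc θ₂
    exact ⟨fun f => C * f (Real.sin θ₁ / √2 * α), fun f g _ _ => mul_add _ _ _,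
      fun c f => mul_left_comm _ _ _, fun φ ψ β => h φ ψ α β⟩
  · obtain ⟨C, p, -, h⟩ := exists_bifracElement_eq_quadTransform hc θ₂
    exact ⟨fun f => quadTransform C p _ _ f α, fun f g hf hg => quadTransform_add hf hg ..,
      fun c f => quadTransform_const_mul .., fun φ ψ β => h φ ψ α β⟩

theorem exists_isBifractional {θ₁ θ₂ : ℝ} (h : Real.cos (θ₁ - θ₂) ≠ 0) (α β : ℝ) :
    ∃ U, IsBifractional α β θ₁ θ₂ U := by
  obtain ⟨K, hK⟩ := exists_norm_bifracElement_le h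
  obtain ⟨T, hadd, hsmul, hT⟩ := exists_bifracElement_eq_linear θ₁ θ₂ α
  have hi := integrable_slicedElement θ₂
  obtain ⟨U, hU⟩ := exists_operator_of_sesq_bound
    (fun φ ψ => (√|Real.cos (θ₁ - θ₂)| : ℂ) * bifracElement θ₁ θ₂ φ ψ α β)
    (fun φ φ' ψ => by
      simp only [hT, slicedElement_add_left, hadd _ _ (hi φ ψ β) (hi φ' ψ β), mul_add])
    (fun c φ ψ => by
      simp only [hT, slicedElement_smul_left, hsmul]; ring)
    (fun φ ψ ψ' => by
      simp only [hT, slicedElement_add_right, hadd _ _ (hi φ ψ β) (hi φ ψ' β), mul_add])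
    (fun c φ ψ => by
      simp only [hT, slicedElement_smul_right, hsmul]; ring)
    (√|Real.cos (θ₁ - θ₂)| * K) (fun φ ψ => by
      rw [norm_mul, Complex.norm_real, Real.norm_of_nonneg (Real.sqrt_nonneg _), mul_assoc]
      gcongr
      exact hK φ ψ α β)
  exact ⟨U, isBifractional_iff.2 hU⟩

theorem isBifractional_bifractional {θ₁ θ₂ : ℝ} (h : Real.cos (θ₁ - θ₂) ≠ 0) (α β : ℝ) :
    IsBifractional α β θ₁ θ₂ (bifractional α β θ₁ θ₂) := by
  have h' := exists_isBifractional h α β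
  rw [bifractional, dif_pos h']
  exact h'.choose_spec

/-! ### Expansions of trace class operators -/

/-- Orthonormal vectors are at distance √2, so the balls of radius 1/2 around them are disjoint, and
L² is separable. -/
theorem countable_of_hilbertBasis {ι : Type*} (b : HilbertBasis ι ℂ StateSpace) : Countable ι := by
  have hd : Set.univ.PairwiseDisjoint fun i : ι => Metric.ball (b i) (1 / 2) := by
    intro i _ j _ hij
    refine Metric.ball_disjoint_ball ?_
    have h1 : ‖b i - b j‖ ^ 2 = 2 := by
      rw [@norm_sub_sq ℂ, b.orthonormal.1 i, b.orthonormal.1 j, b.orthonormal.2 hij]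
      norm_num
    rw [dist_eq_norm]
    nlinarith [norm_nonneg (b i - b j)]
  have : Fact ((2 : ℝ≥0∞) ≠ ⊤) := ⟨by simp⟩
  have := hd.countable_of_isOpen (fun i _ => Metric.isOpen_ball)
    (fun i _ => ⟨b i, Metric.mem_ball_self (by norm_num)⟩)
  exact Set.countable_univ_iff.1 this

/-- Density of Schwartz functions with prescribed speed of approximation. The geometric bound
proportional to ‖f‖ keeps products of two such series absolutely summable. -/
theorem exists_schwartz_series (f : StateSpace) : ∃ g : ℕ → 𝓢(ℝ, ℂ),
    (∀ n, normL2 (g n) ≤ 2 * ‖f‖ * (1 / 2) ^ n) ∧ HasSum (fun n => (g n).toLp 2 volume) f := by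
  rcases eq_or_ne f 0 with rfl | hf
  · refine ⟨fun _ => 0, fun n => ?_, ?_⟩
    · have : (0 : 𝓢(ℝ, ℂ)).toLp 2 volume = 0 := map_zero (SchwartzMap.toLpCLM ℂ ℂ 2 volume)
      simp [normL2, this]
    · have : (0 : 𝓢(ℝ, ℂ)).toLp 2 volume = 0 := map_zero (SchwartzMap.toLpCLM ℂ ℂ 2 volume)
      simp only [this]
      exact hasSum_zero
  · have hpos := norm_pos_iff.2 hf
    let s : AddSubgroup StateSpace :=
      (SchwartzMap.toLpCLM ℂ ℂ 2 (volume : Measure ℝ)).toLinearMap.toAddMonoidHom.range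
    have hmem : f ∈ closure (s : Set StateSpace) := denseRange_schwartz_toLp f
    obtain ⟨v, hv, hvs, hv0, hvn⟩ := controlled_sum_of_mem_closure hmem
      (b := fun n => ‖f‖ * (1 / 2) ^ n) (fun n => by positivity)
    choose g hg using hvs
    have hg' : ∀ n, (g n).toLp 2 volume = v n := hg
    have hb : ∀ n, ‖v n‖ ≤ 2 * ‖f‖ * (1 / 2) ^ n := by
      intro n
      -- The first term is controlled only through its distance, less than ‖f‖, to `f`; hence the
      -- factor 2.
      rcases Nat.eq_zero_or_pos n with rfl | hn
      · have := norm_le_norm_add_norm_sub' (v 0) f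
        rw [neg_add_eq_sub, norm_sub_rev] at hv0
        simp only [pow_zero, mul_one] at hv0 ⊢
        linarith
      · have h2 : 0 < ‖f‖ * (1 / 2) ^ n := by positivity
        have := (hvn n hn).le
        linarith
    have hs : Summable fun n => ‖v n‖ := Summable.of_nonneg_of_le (fun n => norm_nonneg _) hb
      (summable_geometric_two.mul_left _)
    refine ⟨g, fun n => by rw [normL2, hg']; exact hb n, ?_⟩
    simp only [hg']
    have h1 := hs.of_norm.hasSum
    -- The partial sums in `hv` run over `range (n + 1)`, hence the shift by one.
    have h2 := (h1.tendsto_sum_nat).comp (Filter.tendsto_add_atTop_nat 1)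
    rwa [tendsto_nhds_unique hv h2]

/-- `ρ = ∑ |φ_m⟩⟨ψ_m|` with Schwartz functions and an absolutely convergent sum. -/
def HasSchwartzExpansion (ρ : StateSpace →L[ℂ] StateSpace) (φ ψ : ℕ → 𝓢(ℝ, ℂ)) : Prop :=
  (Summable fun m => normL2 (φ m) * normL2 (ψ m)) ∧ ∀ f g : StateSpace,
    HasSum (fun m => inner ℂ f ((φ m).toLp 2 volume) * inner ℂ ((ψ m).toLp 2 volume) g)
      (inner ℂ f (ρ g))

theorem exists_isPositive_sqrt {H : Type*} [NormedAddCommGroup H] [InnerProductSpace ℂ H]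
    [CompleteSpace H] {T : H →L[ℂ] H} (hT : T.IsPositive) :
    ∃ S : H →L[ℂ] H, S.IsPositive ∧ ∀ f, S (S f) = T f := by
  have hpos : 0 ≤ T := (ContinuousLinearMap.nonneg_iff_isPositive T).2 hT
  refine ⟨CFC.sqrt T, (ContinuousLinearMap.nonneg_iff_isPositive _).1 (CFC.sqrt_nonneg T),
    fun f => ?_⟩
  have := CFC.sqrt_mul_sqrt_self T hpos
  exact congrArg (fun T : H →L[ℂ] H => T f) this

/-- Refinement of a rank-one expansion `∑ |f i⟩⟨f i|` when each `f i` is itself expanded. -/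
theorem hasSum_inner_mul_inner_of_series {H ι : Type*} [NormedAddCommGroup H]
    [InnerProductSpace ℂ H] {f : ι → H} (hf : Summable fun i => ‖f i‖ ^ 2) {v : ι → ℕ → H}
    (hvb : ∀ i n, ‖v i n‖ ≤ 2 * ‖f i‖ * (1 / 2) ^ n) (hvs : ∀ i, HasSum (v i) (f i)) :
    (Summable fun k : ι × ℕ × ℕ => ‖v k.1 k.2.1‖ * ‖v k.1 k.2.2‖) ∧ ∀ (x y : H) (c : ℂ),
      HasSum (fun i => inner ℂ x (f i) * inner ℂ (f i) y) c →
      HasSum (fun k : ι × ℕ × ℕ => inner ℂ x (v k.1 k.2.1) * inner ℂ (v k.1 k.2.2) y) c := by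
  have hN : Summable fun k : ι × ℕ × ℕ => ‖v k.1 k.2.1‖ * ‖v k.1 k.2.2‖ := by
    have hgeo : Summable fun n : ℕ => ((1 : ℝ) / 2) ^ n := summable_geometric_two
    have h0 : ∀ n : ℕ, (0 : ℝ) ≤ (1 / 2) ^ n := fun n => by positivity
    -- The majorant is 4‖f i‖² 2^{-j} 2^{-k}.
    have h2 := (hf.mul_left 4).mul_of_nonneg (hgeo.mul_of_nonneg hgeo h0 h0)
      (fun i => by positivity) (fun n => mul_nonneg (h0 _) (h0 _))
    refine Summable.of_nonneg_of_le (fun k => by positivity) (fun k => ?_) h2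
    have := mul_le_mul (hvb k.1 k.2.1) (hvb k.1 k.2.2) (norm_nonneg _) (by positivity)
    refine this.trans_eq ?_
    ring
  refine ⟨hN, fun x y c hc => ?_⟩
  let F : ι × ℕ × ℕ → ℂ := fun k => inner ℂ x (v k.1 k.2.1) * inner ℂ (v k.1 k.2.2) y
  have hF : Summable F := by
    refine Summable.of_norm_bounded (hN.mul_left (‖x‖ * ‖y‖)) fun k => ?_
    rw [norm_mul]
    refine (mul_le_mul (norm_inner_le_norm _ _) (norm_inner_le_norm _ _) (norm_nonneg _)
      (by positivity)).trans_eq ?_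
    ring
  have hfib : ∀ i, HasSum (fun jk : ℕ × ℕ => F (i, jk))
      (inner ℂ x (f i) * inner ℂ (f i) y) := by
    intro i
    have h1 : HasSum (fun j => inner ℂ x (v i j)) (inner ℂ x (f i)) :=
      (innerSL ℂ x).hasSum (hvs i)
    have h2 : HasSum (fun j => inner ℂ (v i j) y) (inner ℂ (f i) y) := by
      have := ((innerSL ℂ y).hasSum (hvs i)).star
      simpa using this
    have h3 : Summable fun jk : ℕ × ℕ => inner ℂ x (v i jk.1) * inner ℂ (v i jk.2) y :=
      hF.comp_injective (i := fun jk : ℕ × ℕ => (i, jk)) (Prod.mk_right_injective i)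
    have h4 := HasSum.mul (f := fun j => inner ℂ x (v i j)) (g := fun j => inner ℂ (v i j) y)
      h1 h2 h3
    change HasSum (fun jk : ℕ × ℕ => inner ℂ x (v i jk.1) * inner ℂ (v i jk.2) y) _
    exact h4
  rw [← (hF.hasSum.prod_fiberwise hfib).unique hc]
  exact hF.hasSum

/-- With S = √ρ and an orthonormal basis b, ρ is the sum of the |S bᵢ⟩⟨S bᵢ|, and ∑ ‖S bᵢ‖² = Tr ρ
is finite. Each S bᵢ is then replaced by a Schwartz series. -/
theorem exists_hasSchwartzExpansion {ρ : StateSpace →L[ℂ] StateSpace} (hρ : IsDensityOperator ρ) :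
    ∃ φ ψ, HasSchwartzExpansion ρ φ ψ := by
  obtain ⟨w, b, -⟩ := exists_hilbertBasis ℂ StateSpace
  have := countable_of_hilbertBasis b
  -- Trace one excludes the empty basis; enumeration by ℕ requires an infinite countable index set.
  have hne : Nonempty w := by
    by_contra hcon
    rw [not_nonempty_iff] at hcon
    have h1 := hρ.2 w b
    exact one_ne_zero (h1.unique hasSum_empty)
  obtain ⟨S, hSpos, hSS⟩ := exists_isPositive_sqrt hρ.1
  have hSsymm : ∀ f g, inner ℂ (S f) g = inner ℂ f (S g) := hSpos.isSymmetric
  have hsum : Summable fun i => ‖S (b i)‖ ^ 2 := by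
    have h1 := (hρ.2 w b).summable
    have h2 : ∀ i, inner ℂ (b i) (ρ (b i)) = ((‖S (b i)‖ ^ 2 : ℝ) : ℂ) := fun i => by
      rw [← hSS, ← hSsymm, inner_self_eq_norm_sq_to_K]; simp
    simp only [h2] at h1
    exact_mod_cast h1
  choose v hvb hvs using fun i => exists_schwartz_series (S (b i))
  obtain ⟨hden⟩ := nonempty_denumerable (w × ℕ × ℕ)
  let eqv : ℕ ≃ w × ℕ × ℕ := (Denumerable.eqv _).symm
  let V : w → ℕ → StateSpace := fun i j => (v i j).toLp 2 volume
  obtain ⟨hN, hF⟩ := hasSum_inner_mul_inner_of_series (v := V) hsum hvb hvs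
  let N : w × ℕ × ℕ → ℝ := fun k => ‖V k.1 k.2.1‖ * ‖V k.1 k.2.2‖
  have hN' : Summable N := hN
  refine ⟨fun m => v (eqv m).1 (eqv m).2.1, fun m => v (eqv m).1 (eqv m).2.2,
    hN'.comp_injective eqv.injective, fun f g => ?_⟩
  have h4 : HasSum (fun i => inner ℂ f (S (b i)) * inner ℂ (S (b i)) g) (inner ℂ f (ρ g)) := by
    have := b.hasSum_inner_mul_inner (S f) (S g)
    rw [hSsymm, hSS] at this
    simpa only [hSsymm] using this
  let F : w × ℕ × ℕ → ℂ := fun k => inner ℂ f (V k.1 k.2.1) * inner ℂ (V k.1 k.2.2) g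
  have hF' : HasSum F (inner ℂ f (ρ g)) := hF f g _ h4
  exact (Equiv.hasSum_iff (f := F) eqv).2 hF'

/-- The double family ⟨T*ψ_m, cᵢ⟩⟨cᵢ, φ_m⟩ is summable by Cauchy–Schwarz, Bessel and the summability
of ‖φ_m‖‖ψ_m‖. Summing over i first gives the series of matrix elements, by Parseval; summing over m
first gives the diagonal of ρT. -/
theorem hasTrace_comp_of_hasSchwartzExpansion {ρ : StateSpace →L[ℂ] StateSpace}
    {φ ψ : ℕ → 𝓢(ℝ, ℂ)} (h : HasSchwartzExpansion ρ φ ψ) (T : StateSpace →L[ℂ] StateSpace) :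
    HasTrace (ρ ∘L T) (∑' m, inner ℂ ((ψ m).toLp 2 volume) (T ((φ m).toLp 2 volume))) := by
  intro ι c
  let x : ℕ → StateSpace := fun m => (φ m).toLp 2 volume
  let y : ℕ → StateSpace := fun m => ContinuousLinearMap.adjoint T ((ψ m).toLp 2 volume)
  let F : ℕ × ι → ℂ := fun k => inner ℂ (y k.1) (c k.2) * inner ℂ (c k.2) (x k.1)
  have hbes : ∀ m, (Summable fun i => ‖F (m, i)‖) ∧ ∑' i, ‖F (m, i)‖ ≤ ‖y m‖ * ‖x m‖ := by
    intro m
    have hs : ∀ z : StateSpace, Summable fun i => ‖inner ℂ (c i) z‖ ^ (2 : ℝ) := fun z => by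
      simpa using c.orthonormal.inner_products_summable z
    have ht : ∀ z : StateSpace, (∑' i, ‖inner ℂ (c i) z‖ ^ (2 : ℝ)) ^ (1 / (2 : ℝ)) ≤ ‖z‖ := by
      intro z
      have := c.orthonormal.tsum_inner_products_le (x := z)
      rw [← Real.sqrt_eq_rpow]
      refine Real.sqrt_le_iff.2 ⟨norm_nonneg _, ?_⟩
      simpa using this
    have := Real.summable_and_inner_le_Lp_mul_Lq_tsum_of_nonneg Real.HolderConjugate.two_two
      (f := fun i => ‖inner ℂ (c i) (y m)‖) (g := fun i => ‖inner ℂ (c i) (x m)‖)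
      (fun i => norm_nonneg _) (fun i => norm_nonneg _) (hs _) (hs _)
    have e : ∀ i, ‖F (m, i)‖ = ‖inner ℂ (c i) (y m)‖ * ‖inner ℂ (c i) (x m)‖ := fun i => by
      simp only [F]
      rw [norm_mul, norm_inner_symm]
    simp only [e]
    refine ⟨this.1, this.2.trans ?_⟩
    exact mul_le_mul (ht _) (ht _) (Real.rpow_nonneg (tsum_nonneg fun i => by positivity) _)
      (norm_nonneg _)
  have hF : Summable F := by
    refine Summable.of_norm ((summable_prod_of_nonneg fun k => norm_nonneg _).2
      ⟨fun m => (hbes m).1, ?_⟩)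
    refine Summable.of_nonneg_of_le (fun m => tsum_nonneg fun i => norm_nonneg _)
      (fun m => (hbes m).2.trans ?_) (h.1.mul_left ‖ContinuousLinearMap.adjoint T‖)
    calc ‖y m‖ * ‖x m‖ ≤ (‖ContinuousLinearMap.adjoint T‖ * normL2 (ψ m)) * normL2 (φ m) := by
          gcongr
          exact ContinuousLinearMap.le_opNorm _ _
      _ = _ := by ring
  have h1 : HasSum (fun m => inner ℂ (y m) (x m)) (∑' k, F k) :=
    hF.hasSum.prod_fiberwise fun m => c.hasSum_inner_mul_inner (y m) (x m)
  have hF' : HasSum (F ∘ Prod.swap) (∑' k, F k) :=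
    (Equiv.hasSum_iff (Equiv.prodComm ι ℕ)).2 hF.hasSum
  have h2 : HasSum (fun i => inner ℂ (c i) (ρ (T (c i)))) (∑' k, F k) := by
    refine hF'.prod_fiberwise fun i => ?_
    have := h.2 (c i) (T (c i))
    refine this.congr_fun fun m => ?_
    simp only [Function.comp, Prod.swap, F, y, x]
    rw [ContinuousLinearMap.adjoint_inner_left, mul_comm]
  have h3 : ∑' m, inner ℂ ((ψ m).toLp 2 volume) (T ((φ m).toLp 2 volume)) = ∑' k, F k := by
    rw [← h1.tsum_eq]
    refine tsum_congr fun m => ?_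
    simp only [y, x, ContinuousLinearMap.adjoint_inner_left]
  rw [h3]
  exact h2

/-! ### The kernel and the Wigner function of a Schwartz expansion -/

/-- The kernel `∑ φ_m(x) conj ψ_m(y)`. -/
def expansionKernel (φ ψ : ℕ → 𝓢(ℝ, ℂ)) (x y : ℝ) : ℂ := ∑' m, φ m x * conj (ψ m y)

/-- The bifractional Wigner function of `∑ |φ_m⟩⟨ψ_m|`, up to the factor `|cos(θ₁-θ₂)|^{1/2}`. -/
def expansionWigner (θ₁ θ₂ : ℝ) (φ ψ : ℕ → 𝓢(ℝ, ℂ)) (α β : ℝ) : ℂ :=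
  ∑' m, bifracElement θ₁ θ₂ (ψ m) (φ m) α β

variable {φ ψ : ℕ → 𝓢(ℝ, ℂ)}

theorem expansionKernel_slice (φ ψ : ℕ → 𝓢(ℝ, ℂ)) (u a : ℝ) :
    expansionKernel φ ψ (u - a / √2) (u + a / √2) = ∑' m, shiftProduct (ψ m) (φ m) u a :=
  tsum_congr fun _ => mul_comm _ _

theorem summable_normL2_comm (hs : Summable fun m => normL2 (φ m) * normL2 (ψ m)) :
    Summable fun m => normL2 (ψ m) * normL2 (φ m) := by
  simpa only [mul_comm] using hs

theorem summable_integral_norm_shiftProduct_right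
    (hs : Summable fun m => normL2 (φ m) * normL2 (ψ m)) (u : ℝ) :
    Summable fun m => ∫ a, ‖shiftProduct (ψ m) (φ m) u a‖ :=
  Summable.of_nonneg_of_le (fun _ => integral_nonneg fun _ => norm_nonneg _)
    (fun m => integral_norm_shiftProduct_right_le (ψ m) (φ m) u)
    ((summable_normL2_comm hs).mul_left _)

theorem integrable_expansionKernel_slice
    (hs : Summable fun m => normL2 (φ m) * normL2 (ψ m)) (u : ℝ) :
    Integrable fun a => expansionKernel φ ψ (u - a / √2) (u + a / √2) := by
  simp only [expansionKernel_slice]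
  exact integrable_tsum_of_summable_integral_norm
    (fun m => integrable_shiftProduct_right (ψ m) (φ m) u)
    (summable_integral_norm_shiftProduct_right hs u)

/-- Valid for every θ, β and u without exceptional sets, which is what makes `expansionKernel` a
version with the marginals at every point. -/
theorem fracFourier_expansionKernel (hs : Summable fun m => normL2 (φ m) * normL2 (ψ m))
    (θ β u : ℝ) :
    fracFourier θ (fun a => expansionKernel φ ψ (u - a / √2) (u + a / √2)) β =
      ∑' m, slicedElement θ (ψ m) (φ m) β u := by
  simp only [expansionKernel_slice, slicedElement]
  by_cases h : Real.sin θ = 0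
  · simp only [fracFourier_of_sin_eq_zero h]
  · simp only [fracFourier_of_sin_ne_zero h, quadTransform, tsum_mul_left]
    congr 1
    simp only [← tsum_mul_left]
    refine (integral_tsum_of_summable_integral_norm (fun m => integrable_phase_mul
      (integrable_shiftProduct_right (ψ m) (φ m) u) (by fun_prop)) ?_).symm
    simpa only [norm_mul, norm_phase, one_mul] using summable_integral_norm_shiftProduct_right hs u

/-- For sin θ = 0 the terms are controlled in L¹(du), otherwise in the supremum norm; testing
against `χ` covers both. -/
theorem summable_integral_norm_mul_slicedElement
    (hs : Summable fun m => normL2 (φ m) * normL2 (ψ m)) (θ β : ℝ) (χ : 𝓢(ℝ, ℂ)) :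
    Summable fun m => ∫ u, ‖χ u‖ * ‖slicedElement θ (ψ m) (φ m) β u‖ := by
  by_cases h : Real.sin θ = 0
  · refine Summable.of_nonneg_of_le (fun m => integral_nonneg fun u => by positivity) (fun m => ?_)
      ((summable_normL2_comm hs).mul_left (SchwartzMap.seminorm ℝ 0 0 χ))
    have h1 : ∫ u, ‖slicedElement θ (ψ m) (φ m) β u‖ ≤ normL2 (ψ m) * normL2 (φ m) := by
      simp only [slicedElement, fracFourier_of_sin_eq_zero h]
      exact integral_norm_shiftProduct_left_le ..
    refine le_trans ?_ (mul_le_mul_of_nonneg_left h1 (apply_nonneg _ _))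
    rw [← integral_const_mul]
    refine integral_mono_of_nonneg (ae_of_all _ fun u => by positivity)
      ((integrable_slicedElement ..).norm.const_mul _) (ae_of_all _ fun u => ?_)
    exact mul_le_mul_of_nonneg_right (χ.norm_le_seminorm ℝ u) (norm_nonneg _)
  · refine Summable.of_nonneg_of_le (fun m => integral_nonneg fun u => by positivity) (fun m => ?_)
      (((summable_normL2_comm hs).mul_left (‖fracConst θ‖ * √2)).mul_left (∫ u, ‖χ u‖))
    rw [← integral_mul_const]
    refine integral_mono_of_nonneg (ae_of_all _ fun u => by positivity)
      (χ.integrable.norm.mul_const _) (ae_of_all _ fun u => ?_)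
    exact mul_le_mul_of_nonneg_left (norm_slicedElement_le h ..) (norm_nonneg _)

/-- The marginal identity for a Schwartz expansion. -/
theorem lintegral_expansionWigner (hs : Summable fun m => normL2 (φ m) * normL2 (ψ m))
    {θ₁ θ₂ : ℝ} (h : Real.cos (θ₁ - θ₂) ≠ 0) (β : ℝ) :
    ∫⁻ α, ‖expansionWigner θ₁ θ₂ φ ψ α β‖ₑ ^ 2 = ENNReal.ofReal (√2 * Real.pi) *
      ∫⁻ u, ‖fracFourier θ₂ (fun a => expansionKernel φ ψ (u - a / √2) (u + a / √2)) β‖ₑ ^ 2 := by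
  have h2 : √2 * √2 = 2 := Real.mul_self_sqrt (by norm_num)
  have h20 : √2 ≠ 0 := by positivity
  simp only [fracFourier_expansionKernel hs, expansionWigner]
  -- The constant is the same in both cases: π · √2 from the evaluation, and |cos θ₁|⁻¹ · 2π|cos
  -- θ₁|/√2 from the transform.
  by_cases hc : Real.cos θ₁ = 0
  · obtain ⟨C, hC, hE⟩ := exists_bifracElement_eq_eval hc θ₂
    have hs2 : |Real.sin θ₁| = 1 := by
      have := Real.sin_sq_add_cos_sq θ₁
      rw [hc] at this
      rw [← sq_eq_sq₀ (abs_nonneg _) zero_le_one, sq_abs]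
      linarith
    have hs0 : Real.sin θ₁ ≠ 0 := fun h0 => by simp [h0] at hs2
    simp only [hE, tsum_mul_left, enorm_mul, mul_pow]
    rw [lintegral_const_mul' _ _ (by simp), lintegral_comp_mul_left
      (fun u => ‖∑' m, slicedElement θ₂ (ψ m) (φ m) β u‖ₑ ^ 2) (div_ne_zero hs0 h20), ← mul_assoc]
    congr 1
    rw [← ofReal_norm, ← ENNReal.ofReal_pow (norm_nonneg _), ← ENNReal.ofReal_mul (by positivity),
      hC, abs_inv, abs_div, hs2, abs_of_pos (by positivity : 0 < √2)]
    congr 1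
    field_simp
  · obtain ⟨C, p, hC, hE⟩ := exists_bifracElement_eq_quadTransform hc θ₂
    -- The L² bound on matrix elements gives the uniformly convergent majorant in α that Plancherel
    -- for series requires.
    obtain ⟨K, hK⟩ := exists_norm_bifracElement_le h
    have hc' : |Real.cos θ₁| ≠ 0 := by simpa using hc
    have hC0 : C ≠ 0 := by
      rintro rfl
      rw [norm_zero, zero_pow two_ne_zero, eq_comm, inv_eq_zero] at hC
      exact hc' hC
    have hr : -(√2 / Real.cos θ₁) ≠ 0 := neg_ne_zero.2 (div_ne_zero h20 hc)
    simp only [hE]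
    rw [lintegral_tsum_quadTransform hC0 _ _ hr (fun m => integrable_slicedElement ..)
      (summable_integral_norm_mul_slicedElement hs θ₂ β)
      ((summable_normL2_comm hs).mul_left K) (fun m α => by rw [← hE]; exact hK ..)]
    congr 2
    rw [hC, abs_neg, abs_div, abs_of_pos (by positivity : 0 < √2)]
    field_simp
    linarith

/-! ### The kernel as a square-integrable function -/

theorem memLp_tensor (f g : 𝓢(ℝ, ℂ)) :
    MemLp (fun z : ℝ × ℝ => f z.1 * conj (g z.2)) 2 volume := by
  have h1 := f.continuous
  have h2 := g.continuous
  have hc : Continuous fun z : ℝ × ℝ => f z.1 * conj (g z.2) := by fun_prop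
  rw [memLp_two_iff_integrable_sq_norm hc.aestronglyMeasurable]
  have hi := (memLp_two_iff_integrable_sq_norm h1.aestronglyMeasurable).1 (f.memLp 2 volume)
  have hi' := (memLp_two_iff_integrable_sq_norm h2.aestronglyMeasurable).1 (g.memLp 2 volume)
  rw [Measure.volume_eq_prod]
  simpa [mul_pow] using hi.mul_prod hi'

/-- The function `f(x) conj g(y)` as an element of `L²(ℝ²)`. -/
def tensorLp (f g : 𝓢(ℝ, ℂ)) : Lp ℂ 2 (volume : Measure (ℝ × ℝ)) := (memLp_tensor f g).toLp _

theorem inner_tensorLp_left (f g : 𝓢(ℝ, ℂ)) (k : Lp ℂ 2 (volume : Measure (ℝ × ℝ))) :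
    inner ℂ (tensorLp f g) k = ∫ z : ℝ × ℝ, conj (f z.1) * k z * g z.2 := by
  rw [L2.inner_def]
  refine integral_congr_ae ?_
  filter_upwards [(memLp_tensor f g).coeFn_toLp] with z hz
  rw [tensorLp, hz]
  simp only [RCLike.inner_apply, map_mul, Complex.conj_conj]
  ring

theorem inner_toLp_toLp (f g : 𝓢(ℝ, ℂ)) :
    inner ℂ (f.toLp 2 volume) (g.toLp 2 volume) = ∫ x, conj (f x) * g x := by
  rw [inner_toLp_left]
  refine integral_congr_ae ?_
  filter_upwards [g.coeFn_toLp 2 volume] with x hx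
  rw [hx]

theorem inner_tensorLp_tensorLp (f g f' g' : 𝓢(ℝ, ℂ)) :
    inner ℂ (tensorLp f g) (tensorLp f' g') =
      inner ℂ (f.toLp 2 volume) (f'.toLp 2 volume) *
        inner ℂ (g'.toLp 2 volume) (g.toLp 2 volume) := by
  rw [inner_tensorLp_left, inner_toLp_toLp, inner_toLp_toLp, ← integral_prod_mul, ← Measure.volume_eq_prod]
  refine integral_congr_ae ?_
  filter_upwards [(memLp_tensor f' g').coeFn_toLp] with z hz
  rw [tensorLp, hz]
  ring

theorem norm_tensorLp (f g : 𝓢(ℝ, ℂ)) : ‖tensorLp f g‖ = normL2 f * normL2 g := by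
  have h := inner_tensorLp_tensorLp f g f g
  simp only [inner_self_eq_norm_sq_to_K] at h
  rw [← sq_eq_sq₀ (norm_nonneg _) (by positivity), mul_pow]
  exact_mod_cast h

/-- Matches the sum in L²(ℝ²) with the pointwise series, so that norms and inner products of the
kernel can be computed in the Hilbert space. -/
theorem coeFn_tsum_tensorLp (hs : Summable fun m => normL2 (φ m) * normL2 (ψ m)) :
    ⇑(∑' m, tensorLp (φ m) (ψ m)) =ᵐ[volume] fun z => expansionKernel φ ψ z.1 z.2 := by
  have h : ∑' m, ‖tensorLp (φ m) (ψ m)‖ₑ ≠ ⊤ := by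
    rw [tsum_enorm_ne_top_iff_summable_norm]
    simpa only [norm_tensorLp] using hs
  filter_upwards [Lp.coeFn_tsum h, ae_all_iff.2 fun m => (memLp_tensor (φ m) (ψ m)).coeFn_toLp]
    with z hz hz'
  rw [hz]
  exact tsum_congr hz'

theorem measurable_expansionKernel (φ ψ : ℕ → 𝓢(ℝ, ℂ)) :
    Measurable fun z : ℝ × ℝ => expansionKernel φ ψ z.1 z.2 := by
  refine Measurable.tsum fun m => ?_
  have h1 := (φ m).continuous
  have h2 := (ψ m).continuous
  exact (by fun_prop : Continuous fun z : ℝ × ℝ => φ m z.1 * conj (ψ m z.2)).measurable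

theorem memLp_expansionKernel (hs : Summable fun m => normL2 (φ m) * normL2 (ψ m)) :
    MemLp (fun z : ℝ × ℝ => expansionKernel φ ψ z.1 z.2) 2 volume :=
  (memLp_congr_ae (coeFn_tsum_tensorLp hs)).1 (Lp.memLp _)

theorem hasSum_tensorLp (hs : Summable fun m => normL2 (φ m) * normL2 (ψ m)) :
    HasSum (fun m => tensorLp (φ m) (ψ m)) (∑' m, tensorLp (φ m) (ψ m)) :=
  (Summable.of_norm (by simpa only [norm_tensorLp] using hs)).hasSum

theorem hasSum_integral_expansionKernel (hs : Summable fun m => normL2 (φ m) * normL2 (ψ m))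
    (f g : 𝓢(ℝ, ℂ)) :
    HasSum (fun m => inner ℂ (f.toLp 2 volume) ((φ m).toLp 2 volume) *
        inner ℂ ((ψ m).toLp 2 volume) (g.toLp 2 volume))
      (∫ z : ℝ × ℝ, conj (f z.1) * expansionKernel φ ψ z.1 z.2 * g z.2) := by
  have h := (innerSL ℂ (tensorLp f g)).hasSum (hasSum_tensorLp hs)
  have e : ∫ z : ℝ × ℝ, conj (f z.1) * expansionKernel φ ψ z.1 z.2 * g z.2 =
      inner ℂ (tensorLp f g) (∑' m, tensorLp (φ m) (ψ m)) := by
    rw [inner_tensorLp_left]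
    refine integral_congr_ae ?_
    filter_upwards [coeFn_tsum_tensorLp hs] with z hz
    rw [hz]
  rw [e]
  simpa only [innerSL_apply_apply, inner_tensorLp_tensorLp] using h

theorem lintegral_expansionKernel (hs : Summable fun m => normL2 (φ m) * normL2 (ψ m)) :
    ∫⁻ z : ℝ × ℝ, ‖expansionKernel φ ψ z.1 z.2‖ₑ ^ 2 =
      ENNReal.ofReal (‖∑' m, tensorLp (φ m) (ψ m)‖ ^ 2) := by
  rw [ENNReal.ofReal_pow (norm_nonneg _), Lp.norm_def, ENNReal.ofReal_toReal (Lp.memLp _).2.ne,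
    eLpNorm_congr_ae (coeFn_tsum_tensorLp hs),
    eLpNorm_eq_lintegral_rpow_enorm_toReal (by norm_num) (by norm_num), ← ENNReal.rpow_natCast,
    ← ENNReal.rpow_mul]
  simp

theorem HasSchwartzExpansion.isPositionKernel {ρ : StateSpace →L[ℂ] StateSpace}
    (h : HasSchwartzExpansion ρ φ ψ) : IsPositionKernel ρ (expansionKernel φ ψ) :=
  ⟨memLp_expansionKernel h.1, fun f g =>
    (h.2 _ _).unique (hasSum_integral_expansionKernel h.1 f g)⟩

/-- The Hilbert-Schmidt norm of a self-adjoint operator and its kernel. -/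
theorem HasSchwartzExpansion.hasTrace_comp_self {ρ : StateSpace →L[ℂ] StateSpace}
    (h : HasSchwartzExpansion ρ φ ψ) (hρ : ρ.IsPositive) :
    HasTrace (ρ ∘L ρ) ((‖∑' m, tensorLp (φ m) (ψ m)‖ ^ 2 : ℝ) : ℂ) := by
  have h1 := hasTrace_comp_of_hasSchwartzExpansion h ρ
  set k := ∑' m, tensorLp (φ m) (ψ m) with hk
  -- Pairing k with its own expansion writes ‖k‖² as the sum of ⟨k, φ_m ⊗ conj ψ_m⟩, which by
  -- symmetry of ρ is the sum of ⟨ψ_m, ρφ_m⟩.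
  have h2 := (innerSL ℂ k).hasSum (hasSum_tensorLp h.1)
  simp only [innerSL_apply_apply, ← hk, inner_self_eq_norm_sq_to_K] at h2
  have h3 : ∀ m, inner ℂ k (tensorLp (φ m) (ψ m)) =
      inner ℂ ((ψ m).toLp 2 volume) (ρ ((φ m).toLp 2 volume)) := by
    intro m
    have h4 : inner ℂ (tensorLp (φ m) (ψ m)) k =
        inner ℂ ((φ m).toLp 2 volume) (ρ ((ψ m).toLp 2 volume)) := by
      rw [inner_tensorLp_left, h.isPositionKernel.2]
      refine integral_congr_ae ?_
      filter_upwards [coeFn_tsum_tensorLp h.1] with z hz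
      rw [hz]
    rw [← inner_conj_symm, h4, inner_conj_symm]
    exact hρ.isSymmetric _ _
  simp only [h3] at h2
  rw [h2.tsum_eq] at h1
  simpa using h1

/-! ### Uniqueness of kernels -/

/-- Varying f shows that, for fixed g, almost every slice d(x,·) has zero pairing with g. Running g
through a countable dense family makes one null set serve all g, so almost every slice vanishes. -/
theorem ae_eq_zero_of_forall_integral_tensor_eq_zero {d : ℝ × ℝ → ℂ} (hd : MemLp d 2 volume)
    (h : ∀ f g : 𝓢(ℝ, ℂ), ∫ z : ℝ × ℝ, conj (f z.1) * d z * g z.2 = 0) : d =ᵐ[volume] 0 := by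
  have hdm : AEStronglyMeasurable d ((volume : Measure ℝ).prod volume) := hd.1
  have hpair : ∀ f g : 𝓢(ℝ, ℂ), Integrable (fun z : ℝ × ℝ => conj (f z.1) * d z * g z.2)
      ((volume : Measure ℝ).prod volume) := fun f g => by
    refine ((memLp_tensor f g).star.integrable_mul hd).congr (ae_of_all _ fun z => ?_)
    simp; ring
  have hzero : ∀ g : 𝓢(ℝ, ℂ), ∀ᵐ x : ℝ, ∫ y, d (x, y) * g y = 0 := by
    intro g
    have e : ∀ (f : 𝓢(ℝ, ℂ)) (x : ℝ), ∫ y, conj (f x) * d (x, y) * g y =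
        conj (f x) * ∫ y, d (x, y) * g y := fun f x => by
      simp only [mul_assoc, integral_const_mul]
    refine ae_eq_of_integral_schwartz_eq (g := fun _ => 0) (fun f => ?_) (fun f => ?_) fun f => ?_
    · simp only [← e]
      exact (hpair f g).integral_prod_left
    · simp
    · simp only [← e, mul_zero, integral_zero]
      rw [← h f g, Measure.volume_eq_prod, integral_prod _ (hpair f g)]
  have hslice : ∀ᵐ x : ℝ, MemLp (fun y => d (x, y)) 2 volume := by
    have hi : Integrable (fun z => ‖d z‖ ^ 2) ((volume : Measure ℝ).prod volume) :=
      (memLp_two_iff_integrable_sq_norm hd.1).1 hd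
    filter_upwards [hi.prod_right_ae, hdm.prodMk_left] with x hx hx'
    exact (memLp_two_iff_integrable_sq_norm hx').2 hx
  have hfact : Fact ((2 : ℝ≥0∞) ≠ ⊤) := ⟨by simp⟩
  obtain ⟨t, hts, htc, htd⟩ := Dense.exists_countable_dense_subset denseRange_schwartz_toLp
  choose g hg using fun e : t => hts e.2
  have := htc.to_subtype
  have hae : ∀ᵐ x : ℝ, ∀ᵐ y : ℝ, d (x, y) = 0 := by
    filter_upwards [hslice, ae_all_iff.2 fun e => hzero (g e)] with x hx hx'
    have h0 : hx.star.toLp = 0 := by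
      refine htd.denseRange_val.eq_of_inner_left ℂ fun e => ?_
      rw [inner_zero_left, ← hx' e, L2.inner_def]
      refine integral_congr_ae ?_
      filter_upwards [hx.star.coeFn_toLp, (g e).coeFn_toLp 2 volume] with y hy hy'
      rw [hy, ← hg e]
      dsimp only
      rw [hy']
      simp [mul_comm]
    have h1 := hx.star.coeFn_toLp
    rw [h0] at h1
    filter_upwards [h1, Lp.coeFn_zero ℂ 2 (volume : Measure ℝ)] with y hy hy'
    simpa [hy'] using hy.symm
  have h1 : ∫⁻ z, ‖d z‖ₑ ∂((volume : Measure ℝ).prod volume) = 0 := by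
    rw [lintegral_prod _ hdm.enorm]
    refine lintegral_eq_zero_of_ae_eq_zero ?_
    filter_upwards [hae] with x hx
    refine lintegral_eq_zero_of_ae_eq_zero ?_
    filter_upwards [hx] with y hy
    simp [hy]
  rw [lintegral_eq_zero_iff' hdm.enorm] at h1
  filter_upwards [h1] with z hz
  simpa using hz

theorem ae_eq_expansionKernel (hs : Summable fun m => normL2 (φ m) * normL2 (ψ m))
    {k : ℝ → ℝ → ℂ} (hk : MemLp (fun z : ℝ × ℝ => k z.1 z.2) 2 volume)
    (h : ∀ f g : 𝓢(ℝ, ℂ), ∫ z : ℝ × ℝ, conj (f z.1) * k z.1 z.2 * g z.2 =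
      ∫ z : ℝ × ℝ, conj (f z.1) * expansionKernel φ ψ z.1 z.2 * g z.2) :
    ∀ᵐ z : ℝ × ℝ, k z.1 z.2 = expansionKernel φ ψ z.1 z.2 := by
  have hK := memLp_expansionKernel hs
  have := ae_eq_zero_of_forall_integral_tensor_eq_zero (hk.sub hK) fun f g => by
    have hi : ∀ {F : ℝ × ℝ → ℂ}, MemLp F 2 volume →
        Integrable fun z : ℝ × ℝ => conj (f z.1) * F z * g z.2 := fun hF => by
      refine ((memLp_tensor f g).star.integrable_mul hF).congr (ae_of_all _ fun z => ?_)
      simp; ring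
    simp only [Pi.sub_apply, mul_sub, sub_mul]
    rw [integral_sub (hi hk) (hi hK), h, sub_self]
  filter_upwards [this] with z hz
  exact sub_eq_zero.1 hz

/-! ### The marginal integral of a kernel -/

/-- `∫ dx |∫ da k(x - a/√2, x + a/√2) Δ(y,a;θ)|²`. -/
def diagonalEnergy (k : ℝ → ℝ → ℂ) (θ y : ℝ) : ℝ≥0∞ :=
  ∫⁻ x, ‖fracFourier θ (fun a => k (x - a / √2) (x + a / √2)) y‖ₑ ^ 2

theorem ae_comp_antidiagonal {P : ℝ → ℝ → Prop} (h : ∀ᵐ z : ℝ × ℝ, P z.1 z.2) :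
    ∀ᵐ z : ℝ × ℝ, P (z.1 - z.2 / √2) (z.1 + z.2 / √2) := by
  have h' : ∀ᵐ z : ℝ × ℝ, P z.2 z.1 :=
    (Measure.measurePreserving_swap (μ := (volume : Measure ℝ))
      (ν := (volume : Measure ℝ))).quasiMeasurePreserving.ae h
  simpa using ae_comp_diagonalEquiv h'

theorem ae_ae_eq_slice {k K : ℝ → ℝ → ℂ} (h : ∀ᵐ z : ℝ × ℝ, k z.1 z.2 = K z.1 z.2) :
    ∀ᵐ x : ℝ, (fun a => k (x - a / √2) (x + a / √2)) =ᵐ[volume]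
      fun a => K (x - a / √2) (x + a / √2) :=
  Measure.ae_ae_of_ae_prod (ae_comp_antidiagonal (P := fun x y => k x y = K x y) h)

/-- For sin θ ≠ 0 the inner transform is an integral over a, unaffected by null sets in almost every
slice, so no `y` is exceptional. For sin θ = 0 it reads the kernel on a line fixed by `y`, and
equality survives only for almost every `y`. -/
theorem diagonalEnergy_congr {k K : ℝ → ℝ → ℂ} (h : ∀ᵐ z : ℝ × ℝ, k z.1 z.2 = K z.1 z.2)
    {θ : ℝ} (hθ : Real.sin θ ≠ 0) (y : ℝ) : diagonalEnergy k θ y = diagonalEnergy K θ y := by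
  refine lintegral_congr_ae ?_
  filter_upwards [ae_ae_eq_slice h] with x hx
  simp only [fracFourier, if_neg hθ]
  congr 2
  refine integral_congr_ae ?_
  filter_upwards [hx] with a ha
  rw [ha]

theorem ae_diagonalEnergy_congr {k K : ℝ → ℝ → ℂ}
    (h : ∀ᵐ z : ℝ × ℝ, k z.1 z.2 = K z.1 z.2) (θ : ℝ) :
    ∀ᵐ y : ℝ, diagonalEnergy k θ y = diagonalEnergy K θ y := by
  by_cases hθ : Real.sin θ = 0
  · have h1 : ∀ᵐ z : ℝ × ℝ, k (z.2 - z.1 / √2) (z.2 + z.1 / √2) =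
        K (z.2 - z.1 / √2) (z.2 + z.1 / √2) :=
      (Measure.measurePreserving_swap (μ := (volume : Measure ℝ))
        (ν := (volume : Measure ℝ))).quasiMeasurePreserving.ae
          (ae_comp_antidiagonal (P := fun x y => k x y = K x y) h)
    have h2 : ∀ᵐ a : ℝ, ∀ᵐ x : ℝ, k (x - a / √2) (x + a / √2) = K (x - a / √2) (x + a / √2) :=
      Measure.ae_ae_of_ae_prod h1
    have h3 : ∀ᵐ y : ℝ, ∀ᵐ x : ℝ, k (x - Real.cos θ * y / √2) (x + Real.cos θ * y / √2) =
        K (x - Real.cos θ * y / √2) (x + Real.cos θ * y / √2) := by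
      rcases Real.sin_eq_zero_iff_cos_eq.1 hθ with hc | hc
      · simpa only [hc, one_mul] using h2
      · simpa only [hc, neg_one_mul] using
          (Measure.measurePreserving_neg (volume : Measure ℝ)).quasiMeasurePreserving.ae h2
    filter_upwards [h3] with y hy
    refine lintegral_congr_ae ?_
    filter_upwards [hy] with x hx
    simp only [fracFourier, if_pos hθ, hx]
  · exact ae_of_all _ fun y => diagonalEnergy_congr h hθ y

/-- Tonelli brings y inside, Plancherel for the fractional transform removes it at every x, and the
change to the coordinates (x - a/√2, x + a/√2) contributes (√2)⁻¹. -/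
theorem lintegral_diagonalEnergy_expansionKernel
    (hs : Summable fun m => normL2 (φ m) * normL2 (ψ m)) (θ : ℝ) :
    ∫⁻ y, diagonalEnergy (expansionKernel φ ψ) θ y =
      ENNReal.ofReal (√2)⁻¹ * ∫⁻ z : ℝ × ℝ, ‖expansionKernel φ ψ z.1 z.2‖ₑ ^ 2 := by
  have hm := (measurable_expansionKernel φ ψ).enorm.pow_const 2
  have h1 : Measurable fun z : ℝ × ℝ => ∑' m, slicedElement θ (ψ m) (φ m) z.1 z.2 :=
    Measurable.tsum fun m => measurable_slicedElement θ (ψ m) (φ m)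
  unfold diagonalEnergy
  have h2 := lintegral_lintegral_swap (μ := (volume : Measure ℝ)) (ν := (volume : Measure ℝ))
    (f := fun y x => ‖∑' m, slicedElement θ (ψ m) (φ m) y x‖ₑ ^ 2)
    (h1.enorm.pow_const 2).aemeasurable
  -- Joint measurability is available for the series form; the integral form is restored after the
  -- exchange.
  simp only [fracFourier_expansionKernel hs]
  rw [h2]
  simp only [← fracFourier_expansionKernel hs,
    lintegral_fracFourier θ (integrable_expansionKernel_slice hs _)]
  have h3 := lintegral_diagonalEquiv (hm.comp measurable_swap)
  have h4 : ∫⁻ z : ℝ × ℝ, ‖expansionKernel φ ψ z.2 z.1‖ₑ ^ 2 =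
      ∫⁻ z : ℝ × ℝ, ‖expansionKernel φ ψ z.1 z.2‖ₑ ^ 2 :=
    (Measure.measurePreserving_swap (μ := (volume : Measure ℝ))
      (ν := (volume : Measure ℝ))).lintegral_comp hm
  simp only [Function.comp, Prod.fst_swap, Prod.snd_swap, diagonalEquiv_apply] at h3
  rw [h4] at h3
  rw [← h3, Measure.volume_eq_prod, lintegral_prod]
  have := hm.comp (diagonalEquiv.measurable.snd.prodMk diagonalEquiv.measurable.fst)
  exact this.aemeasurable

theorem lintegral_expansionWigner_prod (hs : Summable fun m => normL2 (φ m) * normL2 (ψ m))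
    {θ₁ θ₂ : ℝ} (h : Real.cos (θ₁ - θ₂) ≠ 0) :
    ∫⁻ z : ℝ × ℝ, ‖expansionWigner θ₁ θ₂ φ ψ z.1 z.2‖ₑ ^ 2 =
      ENNReal.ofReal (Real.pi * ‖∑' m, tensorLp (φ m) (ψ m)‖ ^ 2) := by
  have hm : Measurable fun z : ℝ × ℝ => expansionWigner θ₁ θ₂ φ ψ z.1 z.2 :=
    Measurable.tsum fun m => measurable_bifracElement θ₁ θ₂ (ψ m) (φ m)
  have hp := lintegral_prod_symm (μ := (volume : Measure ℝ)) (ν := (volume : Measure ℝ)) _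
    (hm.enorm.pow_const 2).aemeasurable
  rw [← Measure.volume_eq_prod] at hp
  rw [hp]
  simp only [lintegral_expansionWigner hs h]
  rw [lintegral_const_mul' _ _ ENNReal.ofReal_ne_top]
  change _ * ∫⁻ y, diagonalEnergy (expansionKernel φ ψ) θ₂ y = _
  rw [lintegral_diagonalEnergy_expansionKernel hs, lintegral_expansionKernel hs,
    ← ENNReal.ofReal_mul (by positivity), ← ENNReal.ofReal_mul (by positivity)]
  congr 1
  field_simp

/-! ### The momentum representation -/

theorem momentumWave_eq_fourier (f : ℝ → ℂ) (p : ℝ) :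
    momentumWave f p = ((√(2 * Real.pi))⁻¹ : ℂ) * (𝓕 f) ((2 * Real.pi)⁻¹ * p) := by
  rw [fourier_eq_integral_phase, momentumWave]
  congr 2
  ext x
  rw [phase, mul_inv_cancel_left₀ (by positivity)]
  congr 2
  push_cast
  ring

/-- The linear change of variables `p ↦ p / (2π)`. -/
def momentumScaling : ℝ ≃L[ℝ] ℝ :=
  ContinuousLinearEquiv.unitsEquivAut ℝ (Units.mk0 (2 * Real.pi)⁻¹ (by positivity))

theorem momentumScaling_apply (p : ℝ) : momentumScaling p = (2 * Real.pi)⁻¹ * p := by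
  simp [momentumScaling, mul_comm]

/-- The momentum wave function of a Schwartz function, as a Schwartz function. -/
def momentum (ψ : 𝓢(ℝ, ℂ)) : 𝓢(ℝ, ℂ) :=
  ((√(2 * Real.pi))⁻¹ : ℂ) • SchwartzMap.compCLMOfContinuousLinearEquiv ℂ momentumScaling (𝓕 ψ)

theorem coe_momentum (ψ : 𝓢(ℝ, ℂ)) : ⇑(momentum ψ) = momentumWave ψ := by
  ext p
  rw [momentumWave_eq_fourier, ← momentumScaling_apply]
  rfl

/-- Testing a momentum kernel against momentum wave functions is thus testing against all Schwartz
functions, which gives its uniqueness. -/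
theorem momentum_surjective : Function.Surjective momentum := by
  intro χ
  have h0 : (√(2 * Real.pi) : ℂ) ≠ 0 := by
    have : √(2 * Real.pi) ≠ 0 := by positivity
    exact_mod_cast this
  refine ⟨𝓕⁻ ((√(2 * Real.pi) : ℂ) •
    SchwartzMap.compCLMOfContinuousLinearEquiv ℂ momentumScaling.symm χ), ?_⟩
  ext p
  rw [momentum, FourierTransform.fourier_fourierInv_eq]
  exact (inv_mul_cancel_left₀ h0 _).trans (congrArg χ (momentumScaling.symm_apply_apply p))

theorem integral_conj_momentumWave_mul {G : ℝ → ℂ} (hG : Integrable G) (χ : 𝓢(ℝ, ℂ)) :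
    ∫ p, conj (momentumWave χ p) * momentumWave G p = ∫ x, conj (χ x) * G x := by
  have h1 := Measure.integral_comp_mul_left (fun x => conj ((𝓕 χ) x) * (𝓕 G) x) (2 * Real.pi)⁻¹
  have hp : 0 < 2 * Real.pi := by positivity
  have h2 : ((√(2 * Real.pi))⁻¹ : ℂ) * ((√(2 * Real.pi))⁻¹ : ℂ) * ((2 * Real.pi : ℝ) : ℂ) = 1 := by
    have : (√(2 * Real.pi))⁻¹ * (√(2 * Real.pi))⁻¹ * (2 * Real.pi) = 1 := by
      rw [← mul_inv, Real.mul_self_sqrt hp.le, inv_mul_cancel₀ hp.ne']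
    exact_mod_cast this
  rw [integral_conj_fourier_mul_fourier hG, inv_inv, abs_of_pos hp, Complex.real_smul] at h1
  have e : ∀ p, conj (momentumWave χ p) * momentumWave G p =
      ((√(2 * Real.pi))⁻¹ : ℂ) * ((√(2 * Real.pi))⁻¹ : ℂ) *
        (conj ((𝓕 χ) ((2 * Real.pi)⁻¹ * p)) * (𝓕 G) ((2 * Real.pi)⁻¹ * p)) := fun p => by
    rw [momentumWave_eq_fourier, momentumWave_eq_fourier, ← SchwartzMap.fourier_coe]
    simp only [map_mul, map_inv₀, Complex.conj_ofReal]
    ring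
  simp only [e]
  rw [integral_const_mul, h1, ← mul_assoc, h2, one_mul]

theorem inner_momentum (φ ψ : 𝓢(ℝ, ℂ)) :
    inner ℂ ((momentum φ).toLp 2 volume) ((momentum ψ).toLp 2 volume) =
      inner ℂ (φ.toLp 2 volume) (ψ.toLp 2 volume) := by
  rw [inner_toLp_toLp, inner_toLp_toLp, coe_momentum, coe_momentum,
    integral_conj_momentumWave_mul ψ.integrable]

theorem normL2_momentum (φ : 𝓢(ℝ, ℂ)) : normL2 (momentum φ) = normL2 φ := by
  have h := inner_momentum φ φ
  simp only [inner_self_eq_norm_sq_to_K] at h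
  rw [← sq_eq_sq₀ (norm_nonneg _) (norm_nonneg _)]
  exact_mod_cast h

theorem momentumWave_phase_mul_translate (ψ : ℝ → ℂ) (a b p : ℝ) :
    momentumWave (fun x => phase (a * b - √2 * b * x) * ψ (x - √2 * a)) p =
      phase (-(a * b) - √2 * a * p) * momentumWave ψ (p + √2 * b) := by
  have h2 : √2 * √2 = 2 := Real.mul_self_sqrt (by norm_num)
  simp only [momentumWave]
  rw [← integral_add_right_eq_self _ (√2 * a), mul_left_comm]
  congr 1
  rw [← integral_const_mul]
  congr 1
  ext x
  have e : ∀ t : ℝ, Complex.exp (-Complex.I * (t : ℂ)) = phase (-t) := fun t => by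
    rw [phase]; congr 1; push_cast; ring
  simp only [e, ← mul_assoc, ← phase_add, add_sub_cancel_right]
  congr 2
  linear_combination (-(a * b)) * h2

/-- Parseval, together with the exchange of translations and modulations under the Fourier
transform: phase space is rotated by a quarter turn. -/
theorem ambiguity_momentum (φ ψ : 𝓢(ℝ, ℂ)) (a b : ℝ) :
    ambiguity (momentum φ) (momentum ψ) (-b) a = ambiguity φ ψ a b := by
  have h2 : √2 * √2 = 2 := Real.mul_self_sqrt (by norm_num)
  have h20 : √2 ≠ 0 := by positivity
  have hG : Integrable fun x => phase (a * b - √2 * b * x) * ψ (x - √2 * a) :=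
    integrable_phase_mul (ψ.integrable.comp_sub_right _) (by fun_prop)
  have h := integral_conj_momentumWave_mul hG φ
  simp only [momentumWave_phase_mul_translate, ← coe_momentum] at h
  simp only [ambiguity, sqrtTwoFourier, shiftProduct]
  have h3 : ∀ t : ℝ, √2 * t - t / √2 = t / √2 := fun t => by
    field_simp
    linear_combination t * h2
  have h4 : ∀ t : ℝ, √2 * (t / √2) = t := fun t => mul_div_cancel₀ t h20
  have hl := integral_sub_right_eq_self (μ := (volume : Measure ℝ)) (fun p =>
    conj (momentum φ p) * (phase (-(a * b) - √2 * a * p) * momentum ψ (p + √2 * b))) (b / √2)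
  have hr := integral_add_right_eq_self (μ := (volume : Measure ℝ)) (fun x =>
    conj (φ x) * (phase (a * b - √2 * b * x) * ψ (x - √2 * a))) (a / √2)
  rw [h, ← hr] at hl
  convert hl using 2
  · ext p
    rw [mul_left_comm, neg_div, sub_neg_eq_add, ← sub_eq_add_neg]
    congr 2
    · congr 1
      linear_combination (-a) * h4 b
    · congr 1
      linear_combination -h3 b
  · ext x
    rw [mul_left_comm]
    congr 2
    · congr 1
      linear_combination b * h4 a
    · congr 1
      linear_combination h3 a

/-- The rotation exchanges the roles of a and b, hence of the two angles, once the order of the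
transforms is interchanged. It reduces the β-marginal to the α-marginal. -/
theorem bifracElement_momentum (θ₁ θ₂ : ℝ) (φ ψ : 𝓢(ℝ, ℂ)) (α β : ℝ) :
    bifracElement θ₂ θ₁ (momentum φ) (momentum ψ) β (-α) = bifracElement θ₁ θ₂ φ ψ α β := by
  unfold bifracElement
  rw [← fracFourier_fracFourier_swap (integrable_ambiguity (momentum φ) (momentum ψ))]
  congr 1
  ext a
  rw [← fracFourier_neg]
  congr 1
  ext b
  exact ambiguity_momentum φ ψ a b

theorem expansionWigner_momentum (θ₁ θ₂ : ℝ) (φ ψ : ℕ → 𝓢(ℝ, ℂ)) (α β : ℝ) :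
    expansionWigner θ₂ θ₁ (fun m => momentum (φ m)) (fun m => momentum (ψ m)) β (-α) =
      expansionWigner θ₁ θ₂ φ ψ α β :=
  tsum_congr fun _ => bifracElement_momentum ..

theorem summable_normL2_momentum (hs : Summable fun m => normL2 (φ m) * normL2 (ψ m)) :
    Summable fun m => normL2 (momentum (φ m)) * normL2 (momentum (ψ m)) := by
  simpa only [normL2_momentum] using hs

theorem HasSchwartzExpansion.isMomentumKernel {ρ : StateSpace →L[ℂ] StateSpace}
    (h : HasSchwartzExpansion ρ φ ψ) : IsMomentumKernel ρ
      (expansionKernel (fun m => momentum (φ m)) (fun m => momentum (ψ m))) := by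
  have hs := summable_normL2_momentum h.1
  refine ⟨memLp_expansionKernel hs, fun f g => ?_⟩
  have h1 := hasSum_integral_expansionKernel hs (momentum f) (momentum g)
  simp only [inner_momentum] at h1
  rw [(h.2 _ _).unique h1]
  simp only [coe_momentum]

/-! ### The bifractional Wigner function -/

theorem IsPositionKernel.ae_eq {ρ : StateSpace →L[ℂ] StateSpace}
    (h : HasSchwartzExpansion ρ φ ψ) {k : ℝ → ℝ → ℂ} (hk : IsPositionKernel ρ k) :
    ∀ᵐ z : ℝ × ℝ, k z.1 z.2 = expansionKernel φ ψ z.1 z.2 :=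
  ae_eq_expansionKernel h.1 hk.1 fun f g => by rw [← hk.2, h.isPositionKernel.2]

theorem IsMomentumKernel.ae_eq {ρ : StateSpace →L[ℂ] StateSpace}
    (h : HasSchwartzExpansion ρ φ ψ) {k : ℝ → ℝ → ℂ} (hk : IsMomentumKernel ρ k) :
    ∀ᵐ z : ℝ × ℝ, k z.1 z.2 =
      expansionKernel (fun m => momentum (φ m)) (fun m => momentum (ψ m)) z.1 z.2 := by
  refine ae_eq_expansionKernel (summable_normL2_momentum h.1) hk.1 fun f g => ?_
  obtain ⟨f, rfl⟩ := momentum_surjective f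
  obtain ⟨g, rfl⟩ := momentum_surjective g
  simp only [coe_momentum]
  rw [← hk.2, h.isMomentumKernel.2]

theorem HasSchwartzExpansion.hasTrace_comp_bifractional {ρ : StateSpace →L[ℂ] StateSpace}
    (h : HasSchwartzExpansion ρ φ ψ) {θ₁ θ₂ : ℝ} (hc : Real.cos (θ₁ - θ₂) ≠ 0) (α β : ℝ) :
    HasTrace (ρ ∘L bifractional α β θ₁ θ₂)
      ((√|Real.cos (θ₁ - θ₂)| : ℂ) * expansionWigner θ₁ θ₂ φ ψ α β) := by
  have h1 := hasTrace_comp_of_hasSchwartzExpansion h (bifractional α β θ₁ θ₂)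
  simp only [isBifractional_iff.1 (isBifractional_bifractional hc α β), tsum_mul_left] at h1
  exact h1

theorem HasSchwartzExpansion.bifracWigner_eq {ρ : StateSpace →L[ℂ] StateSpace}
    (h : HasSchwartzExpansion ρ φ ψ) {θ₁ θ₂ : ℝ} (hc : Real.cos (θ₁ - θ₂) ≠ 0) (α β : ℝ) :
    bifracWigner α β θ₁ θ₂ ρ =
      (√|Real.cos (θ₁ - θ₂)| : ℂ) * expansionWigner θ₁ θ₂ φ ψ α β :=
  (h.hasTrace_comp_bifractional hc α β).opTrace_eq

theorem HasSchwartzExpansion.enorm_bifracWigner_sq {ρ : StateSpace →L[ℂ] StateSpace}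
    (h : HasSchwartzExpansion ρ φ ψ) {θ₁ θ₂ : ℝ} (hc : Real.cos (θ₁ - θ₂) ≠ 0) (α β : ℝ) :
    ‖bifracWigner α β θ₁ θ₂ ρ‖ₑ ^ 2 =
      ENNReal.ofReal |Real.cos (θ₁ - θ₂)| * ‖expansionWigner θ₁ θ₂ φ ψ α β‖ₑ ^ 2 := by
  rw [h.bifracWigner_eq hc, enorm_mul, mul_pow, ← ofReal_norm, Complex.norm_real,
    Real.norm_of_nonneg (Real.sqrt_nonneg _), ← ENNReal.ofReal_pow (Real.sqrt_nonneg _),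
    Real.sq_sqrt (abs_nonneg _)]

/-- A kernel matters only through its energy at this one β, so the statement serves the special
version, almost every β, and every β alike. -/
theorem HasSchwartzExpansion.alphaMarginal {ρ : StateSpace →L[ℂ] StateSpace}
    (h : HasSchwartzExpansion ρ φ ψ) {θ₁ θ₂ : ℝ} (hc : Real.cos (θ₁ - θ₂) ≠ 0)
    {k : ℝ → ℝ → ℂ} {β : ℝ}
    (hk : diagonalEnergy k θ₂ β = diagonalEnergy (expansionKernel φ ψ) θ₂ β) :
    AlphaMarginal ρ k θ₁ θ₂ β := by
  change _ = _ * diagonalEnergy k θ₂ β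
  simp only [h.enorm_bifracWigner_sq hc]
  rw [hk, lintegral_const_mul' _ _ ENNReal.ofReal_ne_top, lintegral_expansionWigner h.1 hc,
    ← mul_assoc, ← ENNReal.ofReal_mul (abs_nonneg _), mul_comm |Real.cos (θ₁ - θ₂)|]
  rfl

theorem HasSchwartzExpansion.betaMarginal {ρ : StateSpace →L[ℂ] StateSpace}
    (h : HasSchwartzExpansion ρ φ ψ) {θ₁ θ₂ : ℝ} (hc : Real.cos (θ₁ - θ₂) ≠ 0)
    {k : ℝ → ℝ → ℂ} {α : ℝ} (hk : diagonalEnergy k θ₁ (-α) = diagonalEnergy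
      (expansionKernel (fun m => momentum (φ m)) (fun m => momentum (ψ m))) θ₁ (-α)) :
    BetaMarginal ρ k θ₁ θ₂ α := by
  have hc' : Real.cos (θ₂ - θ₁) ≠ 0 := by rwa [← Real.cos_neg, neg_sub]
  have e : ∀ p, fracFourier θ₁ (fun b => k (p - (-b) / √2) (p + (-b) / √2)) α =
      fracFourier θ₁ (fun b => k (p - b / √2) (p + b / √2)) (-α) := fun p =>
    fracFourier_neg θ₁ (fun b => k (p - b / √2) (p + b / √2)) α
  unfold BetaMarginal
  simp only [e]
  change _ = _ * diagonalEnergy k θ₁ (-α)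
  simp only [h.enorm_bifracWigner_sq hc, ← expansionWigner_momentum θ₁ θ₂ φ ψ α]
  rw [hk, lintegral_const_mul' _ _ ENNReal.ofReal_ne_top,
    lintegral_expansionWigner (summable_normL2_momentum h.1) hc', ← mul_assoc,
    ← ENNReal.ofReal_mul (abs_nonneg _), mul_comm |Real.cos (θ₁ - θ₂)|]
  rfl

theorem HasSchwartzExpansion.lintegral_bifracWigner {ρ : StateSpace →L[ℂ] StateSpace}
    (h : HasSchwartzExpansion ρ φ ψ) {θ₁ θ₂ : ℝ} (hc : Real.cos (θ₁ - θ₂) ≠ 0) :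
    ∫⁻ z : ℝ × ℝ, ‖bifracWigner z.1 z.2 θ₁ θ₂ ρ‖ₑ ^ 2 = ENNReal.ofReal
      (Real.pi * |Real.cos (θ₁ - θ₂)| * ‖∑' m, tensorLp (φ m) (ψ m)‖ ^ 2) := by
  simp only [h.enorm_bifracWigner_sq hc]
  rw [lintegral_const_mul' _ _ ENNReal.ofReal_ne_top, lintegral_expansionWigner_prod h.1 hc,
    ← ENNReal.ofReal_mul (abs_nonneg _)]
  congr 1
  ring

theorem HasSchwartzExpansion.measurable_bifracWigner {ρ : StateSpace →L[ℂ] StateSpace}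
    (h : HasSchwartzExpansion ρ φ ψ) {θ₁ θ₂ : ℝ} (hc : Real.cos (θ₁ - θ₂) ≠ 0) :
    Measurable fun z : ℝ × ℝ => bifracWigner z.1 z.2 θ₁ θ₂ ρ := by
  simp only [h.bifracWigner_eq hc]
  have hm : Measurable fun z : ℝ × ℝ => expansionWigner θ₁ θ₂ φ ψ z.1 z.2 :=
    Measurable.tsum fun m => measurable_bifracElement θ₁ θ₂ (ψ m) (φ m)
  exact hm.const_mul _

end Bifractional

end

theorem mainTheorem4
    (ρ : Bifractional.StateSpace →L[ℂ] Bifractional.StateSpace)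
    (hρ : Bifractional.IsDensityOperator ρ) :
    -- `⟨x|ρ|y⟩` and `⟨p|ρ|q⟩` exist and have versions with both marginals at every point
    (∃ k : ℝ → ℝ → ℂ, Bifractional.IsPositionKernel ρ k ∧
      ∀ θ₁ θ₂ : ℝ, Real.cos (θ₁ - θ₂) ≠ 0 → ∀ β : ℝ, Bifractional.AlphaMarginal ρ k θ₁ θ₂ β) ∧
    (∃ k : ℝ → ℝ → ℂ, Bifractional.IsMomentumKernel ρ k ∧
      ∀ θ₁ θ₂ : ℝ, Real.cos (θ₁ - θ₂) ≠ 0 → ∀ α : ℝ, Bifractional.BetaMarginal ρ k θ₁ θ₂ α) ∧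
    ∀ θ₁ θ₂ : ℝ, Real.cos (θ₁ - θ₂) ≠ 0 →
      -- `U(α,β;θ₁,θ₂)` and `Tr(ρU)` are well defined
      (∀ α β : ℝ,
        Bifractional.IsBifractional α β θ₁ θ₂ (Bifractional.bifractional α β θ₁ θ₂) ∧
        Bifractional.HasTrace (ρ ∘L Bifractional.bifractional α β θ₁ θ₂)
          (Bifractional.bifracWigner α β θ₁ θ₂ ρ)) ∧
      -- (1) integration over `α`, for every version of `⟨x|ρ|y⟩`
      (∀ k : ℝ → ℝ → ℂ, Bifractional.IsPositionKernel ρ k →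
        (∀ᵐ x : ℝ, MeasureTheory.Integrable (fun a : ℝ => k (x - a / √2) (x + a / √2))) ∧
        (∀ᵐ β : ℝ, Bifractional.AlphaMarginal ρ k θ₁ θ₂ β) ∧
        (Real.sin θ₂ ≠ 0 → ∀ β : ℝ, Bifractional.AlphaMarginal ρ k θ₁ θ₂ β)) ∧
      -- (2) integration over `β`, for every version of `⟨p|ρ|q⟩`
      (∀ k : ℝ → ℝ → ℂ, Bifractional.IsMomentumKernel ρ k →
        (∀ᵐ p : ℝ, MeasureTheory.Integrable (fun b : ℝ => k (p - b / √2) (p + b / √2))) ∧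
        (∀ᵐ α : ℝ, Bifractional.BetaMarginal ρ k θ₁ θ₂ α) ∧
        (Real.sin θ₁ ≠ 0 → ∀ α : ℝ, Bifractional.BetaMarginal ρ k θ₁ θ₂ α)) ∧
      -- (3) integration over both variables
      Bifractional.HasTrace (ρ ∘L ρ) (Bifractional.opTrace (ρ ∘L ρ)) ∧
      MeasureTheory.Integrable
        (fun z : ℝ × ℝ => ‖Bifractional.bifracWigner z.1 z.2 θ₁ θ₂ ρ‖ ^ 2) ∧
      ((∫ z : ℝ × ℝ, ‖Bifractional.bifracWigner z.1 z.2 θ₁ θ₂ ρ‖ ^ 2 : ℝ) : ℂ) =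
        (Real.pi * |Real.cos (θ₁ - θ₂)| : ℝ) * Bifractional.opTrace (ρ ∘L ρ) := by
  obtain ⟨φ, ψ, h⟩ := Bifractional.exists_hasSchwartzExpansion hρ
  -- The kernels of the expansion are themselves the versions valid at every point, so the energies
  -- agree by `rfl`.
  refine ⟨⟨_, h.isPositionKernel, fun θ₁ θ₂ hc β => h.alphaMarginal hc rfl⟩,
    ⟨_, h.isMomentumKernel, fun θ₁ θ₂ hc α => h.betaMarginal hc rfl⟩, fun θ₁ θ₂ hc => ?_⟩
  have hsq := h.hasTrace_comp_self hρ.1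
  have hmeas := h.measurable_bifracWigner hc
  have hint := h.lintegral_bifracWigner hc
  have henorm : ∀ c : ℂ, ‖‖c‖ ^ 2‖ₑ = ‖c‖ₑ ^ 2 := fun c => by simp
  refine ⟨fun α β => ⟨Bifractional.isBifractional_bifractional hc α β, ?_⟩,
    fun k hk => ⟨?_, ?_, fun hs β => ?_⟩, fun k hk => ⟨?_, ?_, fun hs α => ?_⟩, ?_, ?_, ?_⟩
  · rw [h.bifracWigner_eq hc]
    exact h.hasTrace_comp_bifractional hc α β
  · filter_upwards [Bifractional.ae_ae_eq_slice (hk.ae_eq h)] with x hx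
    exact (Bifractional.integrable_expansionKernel_slice h.1 x).congr hx.symm
  · filter_upwards [Bifractional.ae_diagonalEnergy_congr (hk.ae_eq h) θ₂] with β hβ
    exact h.alphaMarginal hc hβ
  · exact h.alphaMarginal hc (Bifractional.diagonalEnergy_congr (hk.ae_eq h) hs β)
  · filter_upwards [Bifractional.ae_ae_eq_slice (hk.ae_eq h)] with x hx
    exact (Bifractional.integrable_expansionKernel_slice
      (Bifractional.summable_normL2_momentum h.1) x).congr hx.symm
  -- The β-marginal at α involves the energy at -α, so the exceptional null set is reflected.
  · filter_upwards [(MeasureTheory.Measure.measurePreserving_neg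
      (MeasureTheory.volume : MeasureTheory.Measure ℝ)).quasiMeasurePreserving.ae
      (Bifractional.ae_diagonalEnergy_congr (hk.ae_eq h) θ₁)] with α hα
    exact h.betaMarginal hc hα
  · exact h.betaMarginal hc (Bifractional.diagonalEnergy_congr (hk.ae_eq h) hs (-α))
  · rwa [hsq.opTrace_eq]
  · refine ⟨(hmeas.norm.pow_const 2).aestronglyMeasurable, ?_⟩
    rw [MeasureTheory.hasFiniteIntegral_iff_enorm]
    simp only [henorm, hint]
    exact ENNReal.ofReal_lt_top
  · rw [hsq.opTrace_eq, ← Complex.ofReal_mul,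
      MeasureTheory.integral_eq_lintegral_of_nonneg_ae (MeasureTheory.ae_of_all _ fun z => sq_nonneg _)
        (hmeas.norm.pow_const 2).aestronglyMeasurable]
    have e : ∀ c : ℂ, ENNReal.ofReal (‖c‖ ^ 2) = ‖c‖ₑ ^ 2 := fun c => by
      rw [ENNReal.ofReal_pow (norm_nonneg c), ofReal_norm]
    simp only [e]
    rw [hint, ENNReal.toReal_ofReal (by positivity)]
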